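/- Consider a stable matching market with men $m_1,\dots,m_M$ and women $w_1,\dots,w_W$, and let $N=\min(M,W)$. Every person has a complete, strictly ordered preference list over all members of the opposite sex, and all these lists are drawn independently. Each man's list is uniformly random. Each woman's list is drawn from a \emph{regular} distribution (possibly different for each woman): for every sequence $a_1,\dots,a_k$ of men ($k \ge 2$), $\Pr[a_1\succ a_2\mid a_2\succ\dots\succ a_k]\le \Pr[a_1\succ a_2]$ whenever the conditioning event has positive probability. For $k\ge 1$ let \[u_k=\max_{w,i}\frac{\Pr[m_{i+k}\succ_w m_i]}{\Pr[m_i\succ_w m_{i+k}]}\in[0,\infty],\] where $w$ ranges over all women and $i$ over $1\le i\le M-k$ (and $u_k=0$ if there are no such $w,i$). Assume that $u_k=\exp(-\Omega(k))$ uniformly over the markets considered, i.e. $u_k\le A e^{-ck}$ for all $k\ge1$, where $A,c>0$ are constants that do not depend on the market. A \emph{stable partner} of a person is someone to whom the person is matched in at least one stable matching. Then: (1) The expected fraction of persons (men and women together) who have more than one stable partner converges to $0$ as the market grows: for every $\varepsilon>0$ there is $n_0$, depending only on $A,c,\varepsilon$, such that this expected fraction is at most $\varepsilon$ in every such market with $M+W\ge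 n_0$ (in particular, in every such market with $N \ge n_0$). (2) The expected number of women who have more than one stable partner is $O(\ln^2 N)$: there is a constant $K$, depending only on $A$ and $c$, such that this expected number is at most $K\ln^2 N$ in every such market with $N\ge2$. -/

import Mathlib

open scoped ENNReal

/-- A complete preference list over `n` persons: a ranking of all of them, where `σ a` is the
position of `a` in the list (position `0` is the favourite). -/
abbrev PrefList (n : ℕ) : Type := Equiv.Perm (Fin n)

/-- `a` is strictly preferred to `b` (written `a ≻ b`) in the list `σ`. -/
def PrefList.Prefers {n : ℕ} (σ : PrefList n) (a b : Fin n) : Prop := σ a < σ b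

/-- A profile of complete preference lists for `M` men and `W` women: a list over the women for
each man (first component) and a list over the men for each woman (second component). -/
abbrev Profile (M W : ℕ) : Type := (Fin M → PrefList W) × (Fin W → PrefList M)

namespace Profile

variable {M W : ℕ}

/-- Man `m` prefers woman `w` to his situation `x` (`none`: single). Lists are complete, so
every woman is preferred to being single. -/
def ManPrefers (P : Profile M W) (m : Fin M) (w : Fin W) (x : Option (Fin W)) : Prop :=
  ∀ w' ∈ x, (P.1 m).Prefers w w'

/-- Woman `w` prefers man `m` to her situation `x` (`none`: single). -/
def WomanPrefers (P : Profile M W) (w : Fin W) (m : Fin M) (x : Option (Fin M)) : Prop :=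
  ∀ m' ∈ x, (P.2 w).Prefers m m'

/-- A matching is a partial bijection `μ` between men and women: `μ m` is the wife of `m`,
`μ.symm w` the husband of `w`, and `none` means single. It is stable if no man and woman both
prefer each other to their situations in `μ`. (As lists are complete, nobody is ever matched to
an unacceptable partner.) -/
def IsStable (P : Profile M W) (μ : Fin M ≃. Fin W) : Prop :=
  ∀ m w, ¬ (P.ManPrefers m w (μ m) ∧ P.WomanPrefers w m (μ.symm w))

/-- `(m, w)` is a stable pair: it belongs to at least one stable matching. -/
def IsStablePair (P : Profile M W) (m : Fin M) (w : Fin W) : Prop :=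
  ∃ μ : Fin M ≃. Fin W, P.IsStable μ ∧ w ∈ μ m

/-- The number of men with at least two distinct stable partners. -/
noncomputable def numMenSeveral (P : Profile M W) : ℕ :=
  {m : Fin M | ∃ w w', w ≠ w' ∧ P.IsStablePair m w ∧ P.IsStablePair m w'}.ncard

/-- The number of women with at least two distinct stable partners. -/
noncomputable def numWomenSeveral (P : Profile M W) : ℕ :=
  {w : Fin W | ∃ m m', m ≠ m' ∧ P.IsStablePair m w ∧ P.IsStablePair m' w}.ncard

end Profile

/-- The probability of `a ≻ b` when the list is drawn from `p`. -/
noncomputable def prefProb {n : ℕ} (p : PMF (PrefList n)) (a b : Fin n) : ℝ≥0∞ :=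
  p.toOuterMeasure {σ | σ.Prefers a b}

/-- The probability of `a₁ ≻ a₂ ≻ ⋯ ≻ aₖ` for `l = [a₁, …, aₖ]` when the list is drawn
from `p`. -/
noncomputable def chainProb {n : ℕ} (p : PMF (PrefList n)) (l : List (Fin n)) : ℝ≥0∞ :=
  p.toOuterMeasure {σ | l.Pairwise σ.Prefers}

/-- A distribution of preference lists is regular if
`ℙ[a₁ ≻ a₂ | a₂ ≻ ⋯ ≻ aₖ] ≤ ℙ[a₁ ≻ a₂]` for all `a₁, a₂, …, aₖ` for which the conditional
probability is defined. -/
def IsRegularPref {n : ℕ} (p : PMF (PrefList n)) : Prop :=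
  ∀ (a b : Fin n) (l : List (Fin n)), chainProb p (b :: l) ≠ 0 →
    chainProb p (a :: b :: l) / chainProb p (b :: l) ≤ prefProb p a b

/-- `u k`: the maximum over all women `w` and all men `i` of the odds
`ℙ[m_{i+k} ≻_w m_i] / ℙ[m_i ≻_w m_{i+k}]`, with value `∞` if some denominator is `0`
(the numerator is then `1`), and `0` if there are no such `w, i`. -/
noncomputable def maxOdds {M W : ℕ} (p : Fin W → PMF (PrefList M)) (k : ℕ) : ℝ≥0∞ :=
  ⨆ (w : Fin W) (i : Fin M) (j : Fin M) (_ : (j : ℕ) = i + k),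
    prefProb (p w) j i / prefProb (p w) i j

/-- The law of the random profile: all lists are independent, each man's list is uniformly
random, and woman `w` draws her list from `p w`. -/
noncomputable def profileLaw {M W : ℕ} (p : Fin W → PMF (PrefList M)) : PMF (Profile M W) :=
  PMF.ofFintype
    (fun P => (∏ m, PMF.uniformOfFintype (PrefList W) (P.1 m)) * ∏ w, p w (P.2 w)) (by
      have hsum : ∀ {n : ℕ} (q : PMF (PrefList n)), ∑ σ, q σ = 1 := fun q => by
        rw [← tsum_fintype (L := .unconditional _)]; exact q.tsum_coe
      rw [Fintype.sum_prod_type]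
      simp_rw [← Finset.mul_sum]
      rw [← Finset.sum_mul, ← Fintype.prod_sum (fun (_ : Fin M) σ =>
          PMF.uniformOfFintype (PrefList W) σ),
        ← Fintype.prod_sum (fun w σ => p w σ)]
      simp only [hsum, Finset.prod_const_one, mul_one])

/-- The expectation of `f` over the random profile. -/
noncomputable def expectation {M W : ℕ} (p : Fin W → PMF (PrefList M))
    (f : Profile M W → ℝ) : ℝ :=
  ∑ P, (profileLaw p P).toReal * f P

/-! Run deferred acceptance with the first `t` men only, and call level `t` secure when every woman
they reach holds a man she prefers to all men numbered `t` or more. At a secure level the reached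
women marry among the first `t` men in every stable matching, so the market splits there. Between
consecutive secure levels `s` and `s + k` lies a block of `k` men who compete only for women not
reached by the first `s`. Suppose that no man's favourite among these women is one of the `r`
favourites of another man of the block, and that each man `x` of the block has among his `r`
favourites a woman still unreached at `s + k` who prefers `x` to all later men. This woman would
block any stable matching giving `x` somebody worse, so `x` always marries one of his `r`
favourites. The only such woman in the block's share is his own favourite, hence `x` is rigid
(`eq_favourite_of_block`). Non-rigid men therefore lie in bad blocks, and fixing one stable matching
injects the women with several stable partners into the non-rigid men.

For the probabilities, lists are revealed only as far as needed. If `w` is first reached after level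
`t`, the procedure reads from her list only the order of her proposers, a chain, and regularity says
that a new man beats its top with at most the unconditional probability
(`IsRegularPref.sum_ite_prefers_le`). With `b = exp (-c)`, the sum of `A * b ^ (j - x)` over `x < u
≤ j` is at most `C = A / (1 - b) ^ 2`. So, given a past that protects its women from level `u` on,
level `u` is secure with probability at least `q = exp (-C)` (`le_womenAvg_secure`), and protection
of the women reached by the first `u` men fails to start by level `u + d` with probability at most
`C * b ^ d` (`womenAvg_not_secure_le`). A renewal argument turns this into a geometric tail for the
gap `k` (`womenAvg_no_secure_le`).

Take `r = k + L`. Uniform lists of the men make a collision cost at most `k ^ 2 * r / (W - s)`. A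
man lacks a saving woman with probability at most `(1 - q) ^ L`, because at least `L` of his `r`
favourites are fresh. Summing `k` times the probability of a bad block, the sum over `k` converges
and the sum over `s < N` gives `(L + 1) * (1 + log N) + N * (1 - q) ^ L` up to a constant. The
choice of `L` near `log N / q` yields the bound `log ^ 2`. Division by `M + W` then settles the
first claim. -/

/-! ### Comparisons in a single list -/

namespace PrefList

variable {n : ℕ} {σ : PrefList n} {a b c : Fin n}

theorem Prefers.trans (h : σ.Prefers a b) (h' : σ.Prefers b c) : σ.Prefers a c :=
  lt_trans (α := Fin n) h h'

theorem Prefers.asymm (h : σ.Prefers a b) : ¬ σ.Prefers b a :=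
  lt_asymm (α := Fin n) h

theorem not_prefers_self : ¬ σ.Prefers a a := lt_irrefl (α := Fin n) _

theorem Prefers.ne (h : σ.Prefers a b) : a ≠ b := by
  rintro rfl; exact not_prefers_self h

theorem prefers_or_prefers (σ : PrefList n) (h : a ≠ b) : σ.Prefers a b ∨ σ.Prefers b a :=
  lt_or_gt_of_ne (α := Fin n) fun e => h (σ.injective e)

theorem not_prefers_iff (h : a ≠ b) : ¬ σ.Prefers a b ↔ σ.Prefers b a :=
  ⟨fun h' => (σ.prefers_or_prefers h).resolve_left h', Prefers.asymm⟩

/-- A nonempty set of persons has a favourite. -/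
theorem exists_favourite (σ : PrefList n) {s : Set (Fin n)} (hs : s.Nonempty) :
    ∃ a ∈ s, ∀ b ∈ s, b ≠ a → σ.Prefers a b := by
  obtain ⟨a, ha, hmin⟩ := Set.exists_min_image s σ s.toFinite hs
  refine ⟨a, ha, fun b hb hne => ?_⟩
  exact lt_of_le_of_ne (hmin b hb) fun e => hne (σ.injective e).symm

theorem induction_on_list (σ : PrefList n) {p : Fin n → Prop}
    (h : ∀ a, (∀ b, σ.Prefers b a → p b) → p a) (a : Fin n) : p a := by
  have : ∀ k : ℕ, ∀ a, (σ a : ℕ) = k → p a := by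
    intro k
    induction k using Nat.strong_induction_on with
    | _ k ih =>
      rintro a rfl
      exact h a fun b hb => ih _ hb b rfl
  exact this _ a rfl

/-- Two lists order the members of `s` in the same way. -/
def AgreeOn (s : Set (Fin n)) (σ τ : PrefList n) : Prop :=
  ∀ a ∈ s, ∀ b ∈ s, σ.Prefers a b ↔ τ.Prefers a b

end PrefList

/-! ### Deferred acceptance run by an initial segment of the men -/

namespace Profile

variable {M W : ℕ}

/-- `P.Proposes t m w`: man `m` proposes to `w` in the deferred acceptance procedure run by the
first `t` men. He does so as soon as all the women he prefers to `w` have rejected him. -/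
inductive Proposes (P : Profile M W) (t : ℕ) : Fin M → Fin W → Prop
  | intro (m : Fin M) (w : Fin W) (y : Fin W → Fin M) (hm : (m : ℕ) < t)
      (hy : ∀ w', (P.1 m).Prefers w' w → Proposes P t (y w') w')
      (hr : ∀ w', (P.1 m).Prefers w' w → (P.2 w').Prefers (y w') m) : Proposes P t m w

variable {P : Profile M W} {s t u : ℕ} {m m' : Fin M} {w w' : Fin W}

theorem proposes_iff : P.Proposes t m w ↔
    (m : ℕ) < t ∧ ∀ w', (P.1 m).Prefers w' w → ∃ y, P.Proposes t y w' ∧ (P.2 w').Prefers y m := by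
  classical
  constructor
  · rintro ⟨_, _, y, hm, hy, hr⟩
    exact ⟨hm, fun w' h => ⟨y w', hy w' h, hr w' h⟩⟩
  · rintro ⟨hm, h⟩
    have : Nonempty (Fin M) := ⟨m⟩
    choose! y hy using h
    exact ⟨m, w, y, hm, fun w' h => (hy w' h).1, fun w' h => (hy w' h).2⟩

theorem Proposes.lt (h : P.Proposes t m w) : (m : ℕ) < t := (proposes_iff.1 h).1

theorem Proposes.of_prefers (h : P.Proposes t m w) (h' : (P.1 m).Prefers w' w) :
    P.Proposes t m w' := by
  rw [proposes_iff] at h ⊢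
  exact ⟨h.1, fun w'' h'' => h.2 w'' (h''.trans h')⟩

theorem Proposes.mono (hst : s ≤ t) (h : P.Proposes s m w) : P.Proposes t m w := by
  induction h with
  | intro m w y hm hy hr ih => exact ⟨m, w, y, hm.trans_le hst, ih, hr⟩

/-- The proposals depend only on the lists of the men involved, and on the comparisons that the
women make between their proposers. -/
theorem proposes_congr {Q : Profile M W} (hmen : ∀ m : Fin M, (m : ℕ) < t → P.1 m = Q.1 m)
    (hw : ∀ w, PrefList.AgreeOn {m | P.Proposes t m w} (P.2 w) (Q.2 w)) :
    P.Proposes t m w ↔ Q.Proposes t m w := by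
  constructor
  · intro h
    induction h with
    | intro m w y hm hy hr ih =>
      have hp : P.Proposes t m w := ⟨m, w, y, hm, hy, hr⟩
      refine ⟨m, w, y, hm, fun w' h => ih w' (hmen m hm ▸ h), fun w' h => ?_⟩
      rw [← hmen m hm] at h
      exact (hw w' _ (hy w' h) _ (hp.of_prefers h)).1 (hr w' h)
  · intro h
    induction h with
    | intro m w y hm hy hr ih =>
      -- Agreement of the lists is known only for men who propose under `P`. So, before `y w'` and
      -- `m` are compared at `w'`, `m` must be shown to propose to `w'` under `P`; this goes by
      -- induction down his list.
      have key : ∀ w'', (w'' = w ∨ (P.1 m).Prefers w'' w) → P.Proposes t m w'' := by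
        intro w''
        induction w'' using (P.1 m).induction_on_list with
        | h w'' ihw =>
          intro hw''
          refine ⟨m, w'', y, hm, fun w' h => ?_, fun w' h => ?_⟩
          all_goals
            have h1 : (P.1 m).Prefers w' w := by
              rcases hw'' with rfl | h2
              · exact h
              · exact h.trans h2
            have h2 : (Q.1 m).Prefers w' w := hmen m hm ▸ h1
          · exact ih w' h2
          · exact (hw w' _ (ih w' h2) _ (ihw w' h (Or.inr h1))).2 (hr w' h2)
      exact key w (Or.inl rfl)

/-- `m` is the favourite of `w` among her proposers. -/
def Holds (P : Profile M W) (t : ℕ) (m : Fin M) (w : Fin W) : Prop :=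
  P.Proposes t m w ∧ ∀ y, P.Proposes t y w → y ≠ m → (P.2 w).Prefers m y

theorem Proposes.exists_holds (h : P.Proposes t m w) : ∃ y, P.Holds t y w := by
  obtain ⟨a, ha, hb⟩ := (P.2 w).exists_favourite (s := {m | P.Proposes t m w}) ⟨m, h⟩
  exact ⟨a, ha, hb⟩

theorem Holds.man_unique (h : P.Holds t m w) (h' : P.Holds t m' w) : m = m' := by
  by_contra hne
  exact (h.2 m' h'.1 (Ne.symm hne)).asymm (h'.2 m h.1 hne)

theorem Holds.woman_unique (h : P.Holds t m w) (h' : P.Holds t m w') : w = w' := by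
  have aux : ∀ {w w'}, P.Holds t m w → P.Holds t m w' → ¬ (P.1 m).Prefers w w' := by
    intro w w' h h' hp
    obtain ⟨y, hy, hym⟩ := (proposes_iff.1 h'.1).2 w hp
    exact (h.2 y hy hym.ne).asymm hym
  by_contra hne
  rcases (P.1 m).prefers_or_prefers hne with h1 | h1
  exacts [aux h h' h1, aux h' h h1]

theorem Holds.mono_prefers (hst : s ≤ t) (h : P.Holds s m w) (h' : P.Holds t m' w) :
    m' = m ∨ (P.2 w).Prefers m' m := by
  by_cases e : m' = m
  · exact Or.inl e
  · exact Or.inr (h'.2 m (h.1.mono hst) (Ne.symm e))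

/-- A man who is held by nobody has proposed to everybody. -/
theorem proposes_of_not_holds (hm : (m : ℕ) < t) (h : ∀ w, ¬ P.Holds t m w) (w : Fin W) :
    P.Proposes t m w := by
  induction w using (P.1 m).induction_on_list with
  | h w ih =>
    refine proposes_iff.2 ⟨hm, fun w' hw' => ?_⟩
    have h1 := h w'
    rw [Holds] at h1
    push Not at h1
    obtain ⟨y, hy, hne, hnp⟩ := h1 (ih w' hw')
    exact ⟨y, hy, (PrefList.not_prefers_iff hne.symm).1 hnp⟩

open Classical in
/-- The women who receive a proposal from one of the first `t` men. -/
noncomputable def reached (P : Profile M W) (t : ℕ) : Finset (Fin W) :=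
  {w | ∃ m, P.Proposes t m w}

theorem mem_reached : w ∈ P.reached t ↔ ∃ m, P.Proposes t m w := by
  simp [reached]

theorem mem_reached_iff_holds : w ∈ P.reached t ↔ ∃ m, P.Holds t m w := by
  rw [mem_reached]
  exact ⟨fun ⟨_, h⟩ => h.exists_holds, fun ⟨m, h⟩ => ⟨m, h.1⟩⟩

theorem reached_mono (hst : s ≤ t) : P.reached s ⊆ P.reached t := fun w hw => by
  rw [mem_reached] at hw ⊢
  exact hw.imp fun _ h => h.mono hst

/-- Each reached woman holds one of the first `t` men, and no man is held twice. -/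
theorem card_reached_le (P : Profile M W) (t : ℕ) : (P.reached t).card ≤ t := by
  classical
  have h : ∀ w ∈ P.reached t, ∃ m, P.Holds t m w := fun w hw => mem_reached_iff_holds.1 hw
  rcases (P.reached t).eq_empty_or_nonempty with h0 | ⟨w₀, hw₀⟩
  · simp [h0]
  have : Nonempty (Fin M) := ⟨(h w₀ hw₀).choose⟩
  choose! f hf using h
  have := Finset.card_le_card_of_injOn (s := P.reached t) (t := Finset.range t)
    (fun w => (f w : ℕ)) (fun w hw => by simpa using (hf w hw).1.lt) (fun w hw w' hw' e => by
      have e' : f w = f w' := Fin.ext e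
      exact (hf w hw).woman_unique (e' ▸ hf w' hw'))
  simpa using this

/-- If some woman is unreached, none of the first `t` men has proposed to everybody, so each of them
is held, by distinct women. -/
theorem le_card_reached (htM : t ≤ M) (h : P.reached t ≠ Finset.univ) :
    t ≤ (P.reached t).card := by
  classical
  have hne : ∃ w, w ∉ P.reached t := by
    by_contra! hc
    exact h (Finset.eq_univ_iff_forall.2 hc)
  obtain ⟨w₀, hw₀⟩ := hne
  have hold : ∀ i : Fin t, ∃ w, P.Holds t (Fin.castLE htM i) w := by
    intro i
    by_contra! hc
    exact hw₀ (mem_reached.2 ⟨_, proposes_of_not_holds (m := Fin.castLE htM i) i.2 hc w₀⟩)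
  choose g hg using hold
  have := Finset.card_le_card_of_injOn (s := (Finset.univ : Finset (Fin t))) (t := P.reached t)
    g (fun i _ => mem_reached_iff_holds.2 ⟨_, hg i⟩) (fun i _ j _ e => by
      have := (hg i).man_unique (e ▸ hg j)
      exact Fin.castLE_injective htM this)
  simpa using this

theorem card_reached_eq (htM : t ≤ M) (h : P.reached t ≠ Finset.univ) :
    (P.reached t).card = t :=
  le_antisymm (P.card_reached_le t) (le_card_reached htM h)

theorem card_reached_eq_of_lt (htM : t ≤ M) (htW : t < W) : (P.reached t).card = t := by
  refine card_reached_eq htM fun h => ?_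
  have := P.card_reached_le t
  rw [h] at this
  simp at this
  omega

theorem reached_eq_univ (htM : t ≤ M) (htW : W ≤ t) : P.reached t = Finset.univ := by
  by_contra h
  have h1 := le_card_reached htM h
  have h2 := (Finset.card_lt_univ_of_notMem (s := P.reached t)
    (x := (Finset.eq_univ_iff_forall.not.trans not_forall |>.1 h).choose)
    (Finset.eq_univ_iff_forall.not.trans not_forall |>.1 h).choose_spec)
  simp at h2
  omega

/-- In a stable matching, every woman is at least as well off as with any of her proposers. -/
theorem Proposes.stable {μ : Fin M ≃. Fin W} (hμ : P.IsStable μ) (h : P.Proposes t m w) :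
    ∃ z, μ.symm w = some z ∧ (z = m ∨ (P.2 w).Prefers z m) := by
  -- The pair `(m, w)` does not block: if `m` has no wife preferred to `w`, then `w` must be at
  -- least as well off as with `m`. The induction supplies the hypothesis, since the women who
  -- rejected `m` are always better off elsewhere.
  have aux : ∀ m w, (∀ w', μ m = some w' → ¬ (P.1 m).Prefers w' w) →
      ∃ z, μ.symm w = some z ∧ (z = m ∨ (P.2 w).Prefers z m) := by
    intro m w hm
    by_cases e : μ m = some w
    · exact ⟨m, (PEquiv.eq_some_iff μ).2 e, Or.inl rfl⟩
    have h1 : P.ManPrefers m w (μ m) := by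
      intro w' hw'
      have hne : w ≠ w' := by
        rintro rfl; exact e hw'
      exact (PrefList.not_prefers_iff hne.symm).1 (hm w' hw')
    have h2 : ¬ P.WomanPrefers w m (μ.symm w) := fun h3 => hμ m w ⟨h1, h3⟩
    rw [WomanPrefers] at h2
    push Not at h2
    obtain ⟨z, hz, hzm⟩ := h2
    refine ⟨z, hz, ?_⟩
    by_cases e : z = m
    · exact Or.inl e
    · exact Or.inr ((PrefList.not_prefers_iff (Ne.symm e)).1 hzm)
  refine aux m w ?_
  induction h with
  | intro m w y hm hy hr ih =>
    intro w' hw' hp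
    obtain ⟨z, hz, hz'⟩ := aux (y w') w' (ih w' hp)
    have hzm : z = m := by
      have : μ.symm w' = some m := (PEquiv.eq_some_iff μ).2 hw'
      rw [hz] at this
      exact Option.some.inj this
    subst hzm
    rcases hz' with h | h
    · exact (hr w' hp).ne h.symm
    · exact (hr w' hp).asymm h

/-! ### Secure levels split every stable matching -/

/-- Every woman reached by the first `u` men prefers the man she holds to all the men from
number `v` on. -/
def Secure (P : Profile M W) (u v : ℕ) : Prop :=
  ∀ m w, P.Holds u m w → ∀ j : Fin M, v ≤ j → (P.2 w).Prefers m j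

theorem Secure.mono {v v' : ℕ} (hv : v ≤ v') (h : P.Secure u v) : P.Secure u v' :=
  fun m w hm j hj => h m w hm j (hv.trans hj)

theorem secure_of_le {v : ℕ} (h : M ≤ v) : P.Secure u v :=
  fun _ _ _ j hj => absurd (j.2.trans_le h) (not_lt.2 hj)

theorem secure_zero : P.Secure 0 0 := fun _ _ h => absurd h.1.lt (Nat.not_lt_zero _)

theorem Secure.prefers_of_mem {v : ℕ} (h : P.Secure u v) (hw : w ∈ P.reached u) {j : Fin M}
    (hj : v ≤ j) : ∃ y, P.Proposes u y w ∧ (P.2 w).Prefers y j := by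
  obtain ⟨y, hy⟩ := mem_reached_iff_holds.1 hw
  exact ⟨y, hy.1, h y w hy j hj⟩

/-- If the first `t` men are secure, a stable matching gives each woman they reach to one
of them. -/
theorem Secure.husband_lt {μ : Fin M ≃. Fin W} (hμ : P.IsStable μ) (h : P.Secure t t)
    (hw : w ∈ P.reached t) : ∃ z : Fin M, (z : ℕ) < t ∧ μ.symm w = some z := by
  obtain ⟨y, hy⟩ := mem_reached_iff_holds.1 hw
  obtain ⟨z, hz, hzy⟩ := hy.1.stable hμ
  refine ⟨z, ?_, hz⟩
  rcases hzy with rfl | hzy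
  · exact hy.1.lt
  · by_contra hc
    exact hzy.asymm (h y w hy z (not_lt.1 hc))

/-- Marriage maps the reached women injectively into the first `t` men; if there are at least `t`
such women, the map is onto. -/
theorem Secure.wife_mem {μ : Fin M ≃. Fin W} (hμ : P.IsStable μ) (h : P.Secure t t)
    (hc : t ≤ (P.reached t).card) (hm : (m : ℕ) < t) :
    ∃ w ∈ P.reached t, μ m = some w := by
  classical
  have h1 : ∀ w ∈ P.reached t, ∃ z : Fin M, (z : ℕ) < t ∧ μ.symm w = some z :=
    fun w hw => h.husband_lt hμ hw
  have : Nonempty (Fin M) := ⟨m⟩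
  choose! f hf using h1
  have hinj : Set.InjOn (fun w => (f w : ℕ)) (P.reached t) := by
    intro w hw w' hw' e
    have e' : f w = f w' := Fin.ext e
    have a := (PEquiv.eq_some_iff μ).1 (hf w hw).2
    have b := (PEquiv.eq_some_iff μ).1 (hf w' hw').2
    rw [e', b] at a
    exact (Option.some.inj a).symm
  have := Finset.surjOn_of_injOn_of_card_le (s := P.reached t) (t := Finset.range t)
    (fun w => (f w : ℕ)) (fun w hw => by simpa using (hf w hw).1) hinj (by simpa using hc)
  obtain ⟨w, hw, e⟩ := this (show (m : ℕ) ∈ (Finset.range t : Set ℕ) by simpa using hm)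
  have e' : f w = m := Fin.ext e
  exact ⟨w, hw, (PEquiv.eq_some_iff μ).1 (e' ▸ (hf w hw).2)⟩

end Profile

/-! ### Favourites within a set -/

namespace PrefList

variable {n : ℕ} {σ : PrefList n} {U : Finset (Fin n)} {a b : Fin n} {r : ℕ}

open Classical in
/-- The number of members of `U` preferred to `a`. -/
noncomputable def rankIn (σ : PrefList n) (U : Finset (Fin n)) (a : Fin n) : ℕ :=
  (U.filter fun b => σ.Prefers b a).card

/-- The `r` favourite members of `U`. -/
noncomputable def topIn (σ : PrefList n) (U : Finset (Fin n)) (r : ℕ) : Finset (Fin n) :=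
  U.filter fun a => σ.rankIn U a < r

theorem mem_topIn : a ∈ σ.topIn U r ↔ a ∈ U ∧ σ.rankIn U a < r := by simp [topIn]

theorem rankIn_lt_rankIn (ha : a ∈ U) (h : σ.Prefers a b) : σ.rankIn U a < σ.rankIn U b := by
  classical
  refine Finset.card_lt_card ⟨fun c hc => ?_, fun hs => ?_⟩
  · simp only [Finset.mem_filter] at hc ⊢
    exact ⟨hc.1, hc.2.trans h⟩
  · have := hs (Finset.mem_filter.2 ⟨ha, h⟩)
    exact not_prefers_self (Finset.mem_filter.1 this).2

theorem rankIn_injOn (σ : PrefList n) (U : Finset (Fin n)) : Set.InjOn (σ.rankIn U) U := by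
  intro a ha b hb e
  by_contra hne
  rcases σ.prefers_or_prefers hne with h | h
  · exact (rankIn_lt_rankIn ha h).ne e
  · exact (rankIn_lt_rankIn hb h).ne e.symm

theorem rankIn_lt_card (ha : a ∈ U) : σ.rankIn U a < U.card := by
  classical
  refine Finset.card_lt_card (Finset.filter_ssubset.2 ⟨a, ha, not_prefers_self⟩)

theorem image_rankIn (σ : PrefList n) (U : Finset (Fin n)) :
    U.image (σ.rankIn U) = Finset.range U.card := by
  refine Finset.eq_of_subset_of_card_le (fun k hk => ?_) ?_
  · obtain ⟨a, ha, rfl⟩ := Finset.mem_image.1 hk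
    exact Finset.mem_range.2 (rankIn_lt_card ha)
  · rw [Finset.card_image_of_injOn (σ.rankIn_injOn U), Finset.card_range]

theorem card_topIn_le (σ : PrefList n) (U : Finset (Fin n)) (r : ℕ) :
    (σ.topIn U r).card ≤ r := by
  have := Finset.card_le_card_of_injOn (s := σ.topIn U r) (t := Finset.range r) (σ.rankIn U)
    (fun a ha => by simpa using (mem_topIn.1 ha).2)
    ((σ.rankIn_injOn U).mono fun a ha => (mem_topIn.1 ha).1)
  simpa using this

theorem le_card_topIn (h : r ≤ U.card) : r ≤ (σ.topIn U r).card := by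
  have : Finset.range r ⊆ (σ.topIn U r).image (σ.rankIn U) := by
    intro k hk
    have hk' : k ∈ U.image (σ.rankIn U) := by
      rw [image_rankIn]
      exact Finset.range_mono h hk
    obtain ⟨a, ha, rfl⟩ := Finset.mem_image.1 hk'
    exact Finset.mem_image_of_mem _ (mem_topIn.2 ⟨ha, Finset.mem_range.1 hk⟩)
  simpa using (Finset.card_le_card this).trans Finset.card_image_le

theorem topIn_of_prefers (ha : a ∈ U) (h : σ.Prefers a b) (hb : b ∈ σ.topIn U r) :
    a ∈ σ.topIn U r :=
  mem_topIn.2 ⟨ha, (rankIn_lt_rankIn ha h).trans (mem_topIn.1 hb).2⟩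

theorem exists_mem_topIn_one (hU : U.Nonempty) : ∃ a, a ∈ σ.topIn U 1 := by
  have := le_card_topIn (σ := σ) (U := U) (r := 1) hU.card_pos
  exact Finset.card_pos.1 this

theorem not_prefers_of_mem_topIn_one (ha : a ∈ σ.topIn U 1) (hb : b ∈ U) :
    ¬ σ.Prefers b a := fun h => by
  have := rankIn_lt_rankIn hb h
  have := (mem_topIn.1 ha).2
  omega

theorem topIn_mono {r' : ℕ} (h : r ≤ r') : σ.topIn U r ⊆ σ.topIn U r' := fun _ ha =>
  mem_topIn.2 ⟨(mem_topIn.1 ha).1, (mem_topIn.1 ha).2.trans_le h⟩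

end PrefList

/-! ### Blocks between secure levels and rigid men -/

namespace Profile

variable {M W : ℕ} {P : Profile M W} {s t r k : ℕ}

/-- Two of the men `s, …, s + k - 1` compete: the favourite of one of them, among the women not
reached by the first `s` men, is among the `r` favourites of the other. -/
def Collides (P : Profile M W) (s k r : ℕ) : Prop :=
  ∃ x y : Fin M, x ≠ y ∧ (s ≤ x ∧ (x : ℕ) < s + k) ∧ (s ≤ y ∧ (y : ℕ) < s + k) ∧
    ∃ w ∈ (P.1 y).topIn (P.reached s)ᶜ 1, w ∈ (P.1 x).topIn (P.reached s)ᶜ r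

/-- Each of the `r` favourites of `x` among the women not reached by the first `s` men is
reached by the first `t` men, or prefers to `x` one of the men from number `t` on. -/
def Unsaved (P : Profile M W) (s t r : ℕ) (x : Fin M) : Prop :=
  ∀ g ∈ (P.1 x).topIn (P.reached s)ᶜ r, g ∉ P.reached t →
    ¬ ∀ j : Fin M, t ≤ j → (P.2 g).Prefers x j

/-- The man `x` is in the same situation in all stable matchings. -/
def IsRigid (P : Profile M W) (x : Fin M) : Prop :=
  ∃ o, ∀ μ : Fin M ≃. Fin W, P.IsStable μ → μ x = o

/-- Without collisions the block's favourites are distinct and exhaust the women newly reached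
between `s` and `t`, and these are the only women the block can marry. A saving woman `g` forces `x`
to marry inside his top `r`, where the only such favourite is his own. -/
theorem eq_favourite_of_block (hsW : s < W) (hst : s < t) (htM : t ≤ M) (hr : 1 ≤ r)
    (hs : P.Secure s s) (ht : P.Secure t t) (hcol : ¬ P.Collides s (t - s) r)
    (hsav : ∀ x : Fin M, s ≤ x → (x : ℕ) < t → ¬ P.Unsaved s t r x) {μ : Fin M ≃. Fin W}
    (hμ : P.IsStable μ) {x : Fin M} (hsx : s ≤ x) (hxt : (x : ℕ) < t) {f : Fin W}
    (hf : f ∈ (P.1 x).topIn (P.reached s)ᶜ 1) : μ x = some f := by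
  classical
  have hcs : (P.reached s).card = s := card_reached_eq_of_lt (by omega) hsW
  have hU : ((P.reached s)ᶜ).Nonempty := by
    rw [← Finset.card_pos, Finset.card_compl, hcs, Fintype.card_fin]
    omega
  have hex := fun y : Fin M => PrefList.exists_mem_topIn_one (σ := P.1 y) hU
  choose F hF using hex
  have hFuniq : ∀ y : Fin M, ∀ w ∈ (P.1 y).topIn (P.reached s)ᶜ 1, w = F y := by
    intro y w hw
    by_contra hne
    rcases (P.1 y).prefers_or_prefers hne with h | h
    · exact PrefList.not_prefers_of_mem_topIn_one (hF y) (PrefList.mem_topIn.1 hw).1 h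
    · exact PrefList.not_prefers_of_mem_topIn_one hw (PrefList.mem_topIn.1 (hF y)).1 h
  have hFU : ∀ y, F y ∉ P.reached s := fun y =>
    Finset.mem_compl.1 (PrefList.mem_topIn.1 (hF y)).1
  have hFt : ∀ y : Fin M, s ≤ y → (y : ℕ) < t → F y ∈ P.reached t := by
    intro y hsy hyt
    refine mem_reached.2 ⟨y, proposes_iff.2 ⟨hyt, fun w' hw' => ?_⟩⟩
    have hw's : w' ∈ P.reached s := by
      by_contra hc
      exact PrefList.not_prefers_of_mem_topIn_one (hF y) (Finset.mem_compl.2 hc) hw'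
    obtain ⟨z, hz, hzy⟩ := hs.prefers_of_mem hw's hsy
    exact ⟨z, hz.mono hst.le, hzy⟩
  -- The block has length `t - s`, so the absence of collisions applies to every ordered pair of its
  -- men.
  have hsep : ∀ y z : Fin M, s ≤ y → (y : ℕ) < t → s ≤ z → (z : ℕ) < t → y ≠ z →
      F y ∉ (P.1 z).topIn (P.reached s)ᶜ r := by
    intro y z hy hy' hz hz' hne hmem
    exact hcol ⟨z, y, hne.symm, ⟨hz, by omega⟩, ⟨hy, by omega⟩, F y, hF y, hmem⟩
  let blk : Finset (Fin M) := Finset.univ.filter fun y => s ≤ (y : ℕ) ∧ (y : ℕ) < t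
  have hblk : blk.card = t - s := by
    have : blk.map Fin.valEmbedding = Finset.Ico s t := by
      ext i
      simp only [blk, Finset.mem_map, Finset.mem_filter, Finset.mem_univ, true_and,
        Fin.valEmbedding_apply, Finset.mem_Ico]
      constructor
      · rintro ⟨y, hy, rfl⟩; exact hy
      · intro hi; exact ⟨⟨i, by omega⟩, hi, rfl⟩
    rw [← Finset.card_map Fin.valEmbedding, this, Nat.card_Ico]
  have hFinj : Set.InjOn F blk := by
    intro y hy z hz e
    by_contra hne
    simp only [blk, Finset.coe_filter, Finset.mem_univ, true_and, Set.mem_ofPred_eq] at hy hz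
    refine hsep y z hy.1 hy.2 hz.1 hz.2 hne (e ▸ PrefList.topIn_mono hr (hF z))
  have hsub : blk.image F ⊆ P.reached t \ P.reached s := by
    intro w hw
    obtain ⟨y, hy, rfl⟩ := Finset.mem_image.1 hw
    simp only [blk, Finset.mem_filter, Finset.mem_univ, true_and] at hy
    exact Finset.mem_sdiff.2 ⟨hFt y hy.1 hy.2, hFU y⟩
  have hcd : (P.reached t \ P.reached s).card + s = (P.reached t).card := by
    conv_rhs => rw [← Finset.card_sdiff_add_card_eq_card (reached_mono (P := P) hst.le), hcs]
  have hct := P.card_reached_le t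
  have hci : (blk.image F).card = t - s := by rw [Finset.card_image_of_injOn hFinj, hblk]
  -- Reaching `t` adds at most `t - s` women, and the `t - s` distinct favourites are all among
  -- them.
  have himg : blk.image F = P.reached t \ P.reached s :=
    Finset.eq_of_subset_of_card_le hsub (by omega)
  have hct' : t ≤ (P.reached t).card := by
    have := Finset.card_le_card hsub
    omega
  have hsU := hsav x hsx hxt
  rw [Unsaved] at hsU
  push Not at hsU
  obtain ⟨g, hg, hgt, hgx⟩ := hsU
  obtain ⟨w, hw, hxw⟩ := ht.wife_mem hμ hct' hxt
  have hws : w ∉ P.reached s := by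
    intro hc
    obtain ⟨z, hz, hz'⟩ := hs.husband_lt hμ hc
    rw [(PEquiv.eq_some_iff μ).2 hxw] at hz'
    have := Option.some.inj hz'
    omega
  have hwi : w ∈ blk.image F := by rw [himg]; exact Finset.mem_sdiff.2 ⟨hw, hws⟩
  obtain ⟨y, hy, rfl⟩ := Finset.mem_image.1 hwi
  simp only [blk, Finset.mem_filter, Finset.mem_univ, true_and] at hy
  have hyx : y = x := by
    by_contra hne
    refine hsep y x hy.1 hy.2 hsx hxt hne ?_
    have hgne : g ≠ F y := by rintro rfl; exact hgt hw
    -- The woman `g` lies outside `P.reached t`, so any husband of hers has number at least `t`, and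
    -- she prefers `x` to him. As `(x, g)` does not block, `x` prefers his wife `F y` to `g`, which
    -- puts `F y` in his top `r` and creates a collision.
    have hnb := hμ x g
    have hwom : P.WomanPrefers g x (μ.symm g) := by
      intro z hz
      refine hgx z ?_
      by_contra hc
      obtain ⟨w', hw', e⟩ := ht.wife_mem hμ hct' (not_le.1 hc)
      rw [(PEquiv.eq_some_iff μ).1 hz] at e
      exact hgt (Option.some.inj e ▸ hw')
    have hnm : ¬ P.ManPrefers x g (μ x) := fun h => hnb ⟨h, hwom⟩
    have : (P.1 x).Prefers (F y) g := by
      by_contra hc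
      refine hnm fun w' hw' => ?_
      rw [hxw] at hw'
      rw [← Option.some.inj hw']
      exact (PrefList.not_prefers_iff hgne.symm).1 hc
    exact PrefList.topIn_of_prefers (PrefList.mem_topIn.1 (hF y)).1 this hg
  rw [hxw, hyx, hFuniq x f hf]

/-- `s` and `s + k` are consecutive secure levels, and the block of men between them is not
known to have unique stable partners. -/
def IsBadBlock (P : Profile M W) (s k r : ℕ) : Prop :=
  P.Secure s s ∧ P.Secure (s + k) (s + k) ∧ (∀ v, s < v → v < s + k → ¬ P.Secure v v) ∧
    (s + r ≤ W → P.Collides s k r ∨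
      ∃ x : Fin M, (s ≤ x ∧ (x : ℕ) < s + k) ∧ P.Unsaved s (s + k) r x)

/-- When `W ≤ s`, all women are reached and marry among the first `s` men, so later men are always
single. -/
theorem isRigid_of_le (hW : W ≤ s) (hs : P.Secure s s) {x : Fin M} (hx : s ≤ x) :
    P.IsRigid x := by
  refine ⟨none, fun μ hμ => ?_⟩
  by_contra hne
  obtain ⟨w, hw⟩ := Option.ne_none_iff_exists'.1 hne
  have : w ∈ P.reached s := by
    rw [reached_eq_univ (by omega) hW]
    exact Finset.mem_univ w
  obtain ⟨z, hz, hz'⟩ := hs.husband_lt hμ this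
  rw [(PEquiv.eq_some_iff μ).2 hw] at hz'
  have := Option.some.inj hz'
  omega

/-- The block is delimited by the last secure level up to `x` and the first one beyond `x`. Both
exist because levels `0` and `M` are secure. -/
theorem exists_isBadBlock {x : Fin M} (hx : ¬ P.IsRigid x) (R : ℕ → ℕ) (hR : ∀ k, 1 ≤ R k) :
    ∃ s k, s < min M W ∧ k ∈ Finset.Icc 1 M ∧ s ≤ x ∧ (x : ℕ) < s + k ∧
      P.IsBadBlock s k (R k) := by
  classical
  have hlow : ∃ s, s ≤ (x : ℕ) ∧ P.Secure s s := ⟨0, Nat.zero_le _, secure_zero⟩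
  have hup : ∃ t, (x : ℕ) < t ∧ P.Secure t t := ⟨M, x.2, secure_of_le le_rfl⟩
  obtain ⟨hxt, ht⟩ := Nat.find_spec hup
  have htmin := fun v (hv : v < Nat.find hup) => Nat.find_min hup hv
  have htM : Nat.find hup ≤ M := Nat.find_min' hup ⟨x.2, secure_of_le le_rfl⟩
  generalize Nat.find hup = t at *
  let s := Nat.findGreatest (fun s => P.Secure s s) x
  have hs : P.Secure s s := Nat.findGreatest_spec (P := fun s => P.Secure s s)
    (Nat.zero_le _) secure_zero
  have hsx : s ≤ x := Nat.findGreatest_le _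
  have hsmax : ∀ v, s < v → v ≤ x → ¬ P.Secure v v := fun v h1 h2 =>
    Nat.findGreatest_is_greatest (P := fun s => P.Secure s s) h1 h2
  have hsW : s < W := by
    by_contra hc
    exact hx (isRigid_of_le (not_lt.1 hc) hs hsx)
  have hst : s + (t - s) = t := by omega
  refine ⟨s, t - s, by have := x.2; omega, Finset.mem_Icc.2 ⟨by omega, by omega⟩, hsx,
    by omega, hs, hst.symm ▸ ht, fun v h1 h2 => ?_, fun _ => ?_⟩
  · by_cases hv : v ≤ x
    · exact hsmax v h1 hv
    · exact fun h => htmin v (by omega) ⟨by omega, h⟩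
  · by_contra! hc
    rw [hst] at hc
    refine hx ?_
    have hU : ((P.reached s)ᶜ).Nonempty := by
      rw [← Finset.card_pos, Finset.card_compl, Fintype.card_fin]
      have := P.card_reached_le s
      omega
    obtain ⟨f, hf⟩ := PrefList.exists_mem_topIn_one (σ := P.1 x) hU
    exact ⟨some f, fun μ hμ => eq_favourite_of_block hsW (by omega) htM (hR _) hs ht hc.1
      (fun y h1 h2 => hc.2 y ⟨h1, h2⟩) hμ hsx hxt hf⟩

theorem card_block_le (M s k : ℕ) :
    (Finset.univ.filter fun x : Fin M => s ≤ (x : ℕ) ∧ (x : ℕ) < s + k).card ≤ k := by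
  have := Finset.card_le_card_of_injOn (s := Finset.univ.filter fun x : Fin M =>
    s ≤ (x : ℕ) ∧ (x : ℕ) < s + k) (t := Finset.Ico s (s + k)) (fun x => (x : ℕ))
    (fun x hx => by simpa using hx) (fun x _ y _ e => Fin.ext e)
  simpa using this

/-- The number of men whose situation is not the same in all stable matchings. -/
noncomputable def numNonRigid (P : Profile M W) : ℕ := {x : Fin M | ¬ P.IsRigid x}.ncard

-- A union bound: each bad block is charged with all of its at most `k` men.
open Classical in
theorem numNonRigid_le (P : Profile M W) (R : ℕ → ℕ) (hR : ∀ k, 1 ≤ R k) :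
    P.numNonRigid ≤ ∑ s ∈ Finset.range (min M W), ∑ k ∈ Finset.Icc 1 M,
      k * (if P.IsBadBlock s k (R k) then 1 else 0) := by
  have hsub : (Finset.univ.filter fun x : Fin M => ¬ P.IsRigid x) ⊆
      (Finset.range (min M W)).biUnion fun s => (Finset.Icc 1 M).biUnion fun k =>
        if P.IsBadBlock s k (R k) then
          Finset.univ.filter fun x : Fin M => s ≤ (x : ℕ) ∧ (x : ℕ) < s + k else ∅ := by
    intro x hx
    obtain ⟨s, k, hs, hk, h1, h2, hb⟩ := exists_isBadBlock (Finset.mem_filter.1 hx).2 R hR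
    simp only [Finset.mem_biUnion]
    refine ⟨s, Finset.mem_range.2 hs, k, hk, ?_⟩
    rw [if_pos hb]
    simp [h1, h2]
  rw [numNonRigid, Set.ncard_eq_toFinset_card', Set.toFinset_ofPred]
  refine (Finset.card_le_card hsub).trans (Finset.card_biUnion_le.trans ?_)
  refine Finset.sum_le_sum fun s _ => Finset.card_biUnion_le.trans ?_
  refine Finset.sum_le_sum fun k _ => ?_
  split_ifs with h
  · simpa using card_block_le M s k
  · simp

theorem numMenSeveral_le (P : Profile M W) : P.numMenSeveral ≤ P.numNonRigid := by
  refine Set.ncard_le_ncard ?_ (Set.toFinite _)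
  rintro m ⟨w, w', hne, ⟨μ, hμ, hw⟩, ⟨μ', hμ', hw'⟩⟩ ⟨o, ho⟩
  have h1 : μ m = some w := hw
  have h2 : μ' m = some w' := hw'
  rw [ho μ hμ] at h1
  rw [ho μ' hμ', h1] at h2
  exact hne (Option.some.inj h2)

/-- A woman who has a husband in some stable matching has one in all of them. -/
theorem IsStable.exists_husband {μ ν : Fin M ≃. Fin W} (hμ : P.IsStable μ) (hν : P.IsStable ν)
    {m : Fin M} {w : Fin W} (h : μ m = some w) : ∃ z, ν.symm w = some z := by
  -- Level `M` is vacuously secure. Unless every woman is reached, all men marry reached women.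
  have hreach : w ∈ P.reached M := by
    by_cases hc : P.reached M = Finset.univ
    · rw [hc]; exact Finset.mem_univ w
    · obtain ⟨w', hw', e⟩ := (secure_of_le le_rfl : P.Secure M M).wife_mem hμ
        (le_card_reached le_rfl hc) m.2
      rw [h] at e
      exact Option.some.inj e ▸ hw'
  obtain ⟨z, _, hz⟩ := (secure_of_le le_rfl : P.Secure M M).husband_lt hν hreach
  exact ⟨z, hz⟩

/-- In a fixed stable matching `ν` the husband of such a woman cannot be rigid: otherwise he would
be her husband in every stable matching. If no stable matching is given, there is nothing to count,
so existence is not needed. -/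
theorem numWomenSeveral_le (P : Profile M W) : P.numWomenSeveral ≤ P.numNonRigid := by
  classical
  by_cases h0 : ∃ ν : Fin M ≃. Fin W, P.IsStable ν
  · obtain ⟨ν, hν⟩ := h0
    have key : ∀ w ∈ {w : Fin W | ∃ m m', m ≠ m' ∧ P.IsStablePair m w ∧ P.IsStablePair m' w},
        ∃ z, ν.symm w = some z ∧ ¬ P.IsRigid z := by
      rintro w ⟨m, m', hne, ⟨μ, hμ, hw⟩, ⟨μ', hμ', hw'⟩⟩
      obtain ⟨z, hz⟩ := hμ.exists_husband hν hw
      refine ⟨z, hz, ?_⟩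
      rintro ⟨o, ho⟩
      have hzo : some w = o := by
        rw [← ho ν hν]; exact ((PEquiv.eq_some_iff ν).1 hz).symm
      have h1 := (PEquiv.eq_some_iff μ).2 ((ho μ hμ).trans hzo.symm)
      have h2 := (PEquiv.eq_some_iff μ').2 ((ho μ' hμ').trans hzo.symm)
      rw [(PEquiv.eq_some_iff μ).2 hw] at h1
      rw [(PEquiv.eq_some_iff μ').2 hw'] at h2
      exact hne ((Option.some.inj h1).trans (Option.some.inj h2).symm)
    by_cases h1 : Nonempty (Fin M)
    · choose! z hz using key
      refine Set.ncard_le_ncard_of_injOn z (fun w hw => (hz w hw).2) ?_ (Set.toFinite _)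
      intro w hw w' hw' e
      have h2 := (PEquiv.eq_some_iff ν).1 (hz w hw).1
      rw [e, (PEquiv.eq_some_iff ν).1 (hz w' hw').1] at h2
      exact (Option.some.inj h2).symm
    · have : P.numWomenSeveral = 0 := by
        rw [numWomenSeveral, Set.ncard_eq_zero]
        ext w
        simp only [Set.mem_ofPred_eq, Set.mem_empty_iff_false, iff_false]
        rintro ⟨m, _⟩
        exact h1 ⟨m⟩
      omega
  · have : P.numWomenSeveral = 0 := by
      rw [numWomenSeveral, Set.ncard_eq_zero]
      ext w
      simp only [Set.mem_ofPred_eq, Set.mem_empty_iff_false, iff_false]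
      rintro ⟨m, m', hne, ⟨μ, hμ, hw⟩, _⟩
      exact h0 ⟨μ, hμ⟩
    omega

end Profile

/-! ### Partial information about a list as a chain -/

namespace PrefList

variable {n : ℕ}

theorem AgreeOn.refl (s : Set (Fin n)) (σ : PrefList n) : AgreeOn s σ σ :=
  fun _ _ _ _ => Iff.rfl

theorem AgreeOn.symm {s : Set (Fin n)} {σ τ : PrefList n} (h : AgreeOn s σ τ) :
    AgreeOn s τ σ := fun a ha b hb => (h a ha b hb).symm

theorem AgreeOn.trans {s : Set (Fin n)} {σ τ υ : PrefList n} (h : AgreeOn s σ τ)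
    (h' : AgreeOn s τ υ) : AgreeOn s σ υ :=
  fun a ha b hb => (h a ha b hb).trans (h' a ha b hb)

open Classical in
/-- The members of `s`, from the favourite to the least preferred one. -/
noncomputable def sorted (σ : PrefList n) (s : Set (Fin n)) : List (Fin n) :=
  ((List.finRange n).map σ.symm).filter fun a => a ∈ s

theorem mem_sorted {σ : PrefList n} {s : Set (Fin n)} {a : Fin n} :
    a ∈ σ.sorted s ↔ a ∈ s := by
  simp only [sorted, List.mem_filter, List.mem_map, List.mem_finRange, true_and,
    decide_eq_true_eq, and_iff_right_iff_imp]
  exact fun _ => ⟨σ a, by simp⟩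

theorem pairwise_sorted (σ : PrefList n) (s : Set (Fin n)) :
    (σ.sorted s).Pairwise σ.Prefers := by
  refine List.Pairwise.filter _ (List.pairwise_map.2 ?_)
  refine (List.pairwise_lt_finRange n).imp fun {a b} h => ?_
  simpa [Prefers] using h

/-- This turns "the same order on `s`" into a chain event, the form in which regularity is stated.
-/
theorem pairwise_sorted_iff {σ τ : PrefList n} {s : Set (Fin n)} :
    (σ.sorted s).Pairwise τ.Prefers ↔ AgreeOn s σ τ := by
  constructor
  · intro h a ha b hb
    have h2 := (σ.pairwise_sorted s).and h
    have h3 : (σ.sorted s).Pairwise fun a b => (σ.Prefers a b ↔ τ.Prefers a b) ∧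
        (σ.Prefers b a ↔ τ.Prefers b a) := h2.imp fun {a b} hab =>
      ⟨iff_of_true hab.1 hab.2, iff_of_false hab.1.asymm hab.2.asymm⟩
    have : Std.Symm fun a b => (σ.Prefers a b ↔ τ.Prefers a b) ∧
        (σ.Prefers b a ↔ τ.Prefers b a) := ⟨fun _ _ h => ⟨h.2, h.1⟩⟩
    have h4 := h3.forall_of_forall (fun _ _ => ⟨iff_of_false
      not_prefers_self not_prefers_self, iff_of_false not_prefers_self not_prefers_self⟩)
    exact (h4 (mem_sorted.2 ha) (mem_sorted.2 hb)).1
  · intro h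
    refine (σ.pairwise_sorted s).imp_of_mem fun {a b} ha hb hab => ?_
    exact (h a (mem_sorted.1 ha) b (mem_sorted.1 hb)).1 hab

theorem sorted_eq_cons {σ : PrefList n} {s : Set (Fin n)} {a : Fin n} (ha : a ∈ s)
    (h : ∀ b ∈ s, b ≠ a → σ.Prefers a b) : ∃ l, σ.sorted s = a :: l := by
  have hp := σ.pairwise_sorted s
  have hm : a ∈ σ.sorted s := mem_sorted.2 ha
  cases hl : σ.sorted s with
  | nil => simp [hl] at hm
  | cons b l =>
    have hb : b ∈ s := (mem_sorted (σ := σ)).1 (by rw [hl]; exact List.mem_cons_self)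
    by_cases e : b = a
    · exact ⟨l, by rw [e]⟩
    · rw [hl] at hp hm
      have h1 : a ∈ l := (List.mem_cons.1 hm).resolve_left (Ne.symm e)
      exact absurd (h b hb e) ((List.pairwise_cons.1 hp).1 a h1).asymm

end PrefList

/-! ### Regular distributions: a chain's top against new men -/

section Regular

variable {n : ℕ} {p : PMF (PrefList n)}

theorem toReal_toOuterMeasure (p : PMF (PrefList n)) (q : PrefList n → Prop)
    [DecidablePred q] :
    (p.toOuterMeasure {σ | q σ}).toReal = ∑ σ, (p σ).toReal * (if q σ then 1 else 0) := by
  rw [PMF.toOuterMeasure_apply_fintype, ENNReal.toReal_sum]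
  · refine Finset.sum_congr rfl fun σ _ => ?_
    by_cases h : q σ <;> simp [h]
  · intro σ _
    by_cases h : q σ <;> simp [h, p.apply_ne_top]

theorem sum_toReal_pmf {α : Type*} [Fintype α] (p : PMF α) : ∑ σ, (p σ).toReal = 1 := by
  rw [← ENNReal.toReal_sum fun σ _ => p.apply_ne_top σ, ← tsum_fintype (L := .unconditional _),
    p.tsum_coe, ENNReal.toReal_one]

theorem toOuterMeasure_ne_top (p : PMF (PrefList n)) (E : Set (PrefList n)) :
    p.toOuterMeasure E ≠ ⊤ := by
  classical
  rw [PMF.toOuterMeasure_apply_fintype]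
  refine ENNReal.sum_ne_top.2 fun σ _ => ?_
  by_cases h : σ ∈ E <;> simp [h, p.apply_ne_top]

theorem IsRegularPref.chainProb_cons_le (hp : IsRegularPref p) (j a : Fin n)
    (l : List (Fin n)) : chainProb p (j :: a :: l) ≤ prefProb p j a * chainProb p (a :: l) := by
  by_cases h : chainProb p (a :: l) = 0
  · rw [h, mul_zero, ← h]
    exact MeasureTheory.measure_mono fun σ hσ => (List.pairwise_cons.1 hσ).2
  · exact (ENNReal.div_le_iff h (toOuterMeasure_ne_top _ _)).1 (hp j a l h)

open Classical in
/-- A man outside the known comparisons beats the current favourite with at most the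
unconditional probability. -/
theorem IsRegularPref.sum_ite_prefers_le (hp : IsRegularPref p) {S : PrefList n → Set (Fin n)}
    {Φ : PrefList n → ℝ} (hΦ : ∀ σ, 0 ≤ Φ σ) (a j : Fin n)
    (hloc : ∀ σ τ, PrefList.AgreeOn (S σ) σ τ → S τ = S σ ∧ Φ τ = Φ σ)
    (htop : ∀ σ, Φ σ ≠ 0 → a ∈ S σ ∧ ∀ b ∈ S σ, b ≠ a → σ.Prefers a b) :
    ∑ σ, (p σ).toReal * (Φ σ * (if σ.Prefers j a then 1 else 0)) ≤
      (prefProb p j a).toReal * ∑ σ, (p σ).toReal * Φ σ := by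
  -- `κ σ` is the set of lists not distinguishable from `σ` by the revealed comparisons. As `S` is
  -- constant on it, by `hloc`, these cells partition the lists, and regularity is applied cell by
  -- cell.
  let κ : PrefList n → Finset (PrefList n) := fun σ =>
    Finset.univ.filter fun τ => PrefList.AgreeOn (S σ) σ τ
  have hκ : ∀ σ τ, κ τ = κ σ ↔ τ ∈ κ σ := by
    intro σ τ
    constructor
    · intro h
      rw [← h]
      exact Finset.mem_filter.2 ⟨Finset.mem_univ _, PrefList.AgreeOn.refl _ _⟩
    · intro h
      have h1 := (Finset.mem_filter.1 h).2
      have h2 := (hloc σ τ h1).1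
      ext υ
      simp only [κ, Finset.mem_filter, Finset.mem_univ, true_and, h2]
      exact ⟨fun h3 => h1.trans h3, fun h3 => h1.symm.trans h3⟩
  rw [← Finset.sum_fiberwise_of_maps_to (s := Finset.univ) (t := Finset.univ.image κ) (g := κ)
      (fun σ _ => Finset.mem_image_of_mem _ (Finset.mem_univ σ)),
    ← Finset.sum_fiberwise_of_maps_to (s := Finset.univ) (t := Finset.univ.image κ) (g := κ)
      (fun σ _ => Finset.mem_image_of_mem _ (Finset.mem_univ σ))
      (fun σ => (p σ).toReal * Φ σ), Finset.mul_sum]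
  refine Finset.sum_le_sum fun K hK => ?_
  obtain ⟨σ, _, rfl⟩ := Finset.mem_image.1 hK
  have hfib : (Finset.univ.filter fun τ => κ τ = κ σ) = κ σ := by
    ext τ; simp [hκ]
  rw [hfib]
  have hΦK : ∀ τ ∈ κ σ, Φ τ = Φ σ := fun τ hτ => (hloc σ τ (Finset.mem_filter.1 hτ).2).2
  have h1 : ∑ τ ∈ κ σ, (p τ).toReal * (Φ τ * (if τ.Prefers j a then 1 else 0)) =
      Φ σ * ∑ τ ∈ κ σ, (p τ).toReal * (if τ.Prefers j a then 1 else 0) := by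
    rw [Finset.mul_sum]
    refine Finset.sum_congr rfl fun τ hτ => ?_
    rw [hΦK τ hτ]; ring
  have h2 : ∑ τ ∈ κ σ, (p τ).toReal * Φ τ = Φ σ * ∑ τ ∈ κ σ, (p τ).toReal := by
    rw [Finset.mul_sum]
    refine Finset.sum_congr rfl fun τ hτ => ?_
    rw [hΦK τ hτ]; ring
  rw [h1, h2]
  by_cases h0 : Φ σ = 0
  · simp [h0]
  obtain ⟨ha, hb⟩ := htop σ h0
  obtain ⟨l, hl⟩ := PrefList.sorted_eq_cons ha hb
  -- A cell with `Φ σ ≠ 0` is exactly a chain event with top `a`.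
  have hmem : ∀ τ, τ ∈ κ σ ↔ (a :: l).Pairwise τ.Prefers := by
    intro τ
    rw [← hl, PrefList.pairwise_sorted_iff]
    simp [κ]
  have h3 : ∑ τ ∈ κ σ, (p τ).toReal = (chainProb p (a :: l)).toReal := by
    rw [chainProb, toReal_toOuterMeasure, ← Finset.sum_filter_add_sum_filter_not Finset.univ
      (fun τ => τ ∈ κ σ)]
    rw [Finset.sum_eq_zero (s := Finset.univ.filter fun τ => τ ∉ κ σ), add_zero]
    · refine Finset.sum_congr (by ext; simp) fun τ hτ => ?_
      rw [if_pos ((hmem τ).1 (by simpa using hτ)), mul_one]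
    · intro τ hτ
      rw [if_neg (fun h => (Finset.mem_filter.1 hτ).2 ((hmem τ).2 h)), mul_zero]
  have h4 : ∑ τ ∈ κ σ, (p τ).toReal * (if τ.Prefers j a then 1 else 0) ≤
      (chainProb p (j :: a :: l)).toReal := by
    rw [chainProb, toReal_toOuterMeasure]
    refine (Finset.sum_le_sum fun τ hτ => ?_).trans (Finset.sum_le_sum_of_subset_of_nonneg
      (Finset.subset_univ (κ σ)) fun τ _ _ => ?_)
    · have h5 := (hmem τ).1 hτ
      by_cases hj : τ.Prefers j a
      · have h6 : (j :: a :: l).Pairwise τ.Prefers := by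
          refine List.pairwise_cons.2 ⟨fun b hb => ?_, h5⟩
          rcases List.mem_cons.1 hb with rfl | hb
          · exact hj
          · exact hj.trans ((List.pairwise_cons.1 h5).1 b hb)
        rw [if_pos hj, if_pos h6]
      · rw [if_neg hj, mul_zero]
        exact mul_nonneg ENNReal.toReal_nonneg (by split_ifs <;> norm_num)
    · exact mul_nonneg ENNReal.toReal_nonneg (by split_ifs <;> norm_num)
  have h5 := ENNReal.toReal_mono (ENNReal.mul_ne_top (toOuterMeasure_ne_top _ _)
    (toOuterMeasure_ne_top _ _)) (hp.chainProb_cons_le j a l)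
  rw [ENNReal.toReal_mul] at h5
  rw [h3]
  calc _ ≤ Φ σ * ((prefProb p j a).toReal * (chainProb p (a :: l)).toReal) :=
        mul_le_mul_of_nonneg_left (h4.trans h5) (hΦ σ)
    _ = _ := by ring

theorem prefProb_toReal_add (p : PMF (PrefList n)) {a j : Fin n} (h : a ≠ j) :
    (prefProb p a j).toReal + (prefProb p j a).toReal = 1 := by
  classical
  rw [prefProb, prefProb, toReal_toOuterMeasure, toReal_toOuterMeasure,
    ← Finset.sum_add_distrib]
  refine Eq.trans ?_ (sum_toReal_pmf p)
  refine Finset.sum_congr rfl fun σ _ => ?_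
  rcases σ.prefers_or_prefers h with h1 | h1
  · rw [if_pos h1, if_neg h1.asymm]; ring
  · rw [if_pos h1, if_neg h1.asymm]; ring

open Classical in
/-- The current favourite beats all the men of a finite set with at least the product of the
unconditional probabilities. -/
theorem IsRegularPref.prod_mul_sum_le (hp : IsRegularPref p) {a : Fin n} (J : Finset (Fin n)) :
    ∀ {S : PrefList n → Set (Fin n)} {Φ : PrefList n → ℝ}, (∀ σ, 0 ≤ Φ σ) →
    (∀ σ τ, PrefList.AgreeOn (S σ) σ τ → S τ = S σ ∧ Φ τ = Φ σ) →
    (∀ σ, Φ σ ≠ 0 → a ∈ S σ ∧ ∀ b ∈ S σ, b ≠ a → σ.Prefers a b) → a ∉ J →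
    (∏ j ∈ J, (prefProb p a j).toReal) * ∑ σ, (p σ).toReal * Φ σ ≤
      ∑ σ, (p σ).toReal * (Φ σ * (if ∀ j ∈ J, σ.Prefers a j then 1 else 0)) := by
  induction J using Finset.induction_on with
  | empty => intros; simp
  | insert j J hj ih =>
    intro S Φ hΦ hloc htop haJ
    simp only [Finset.mem_insert, not_or] at haJ
    have hstep : (prefProb p a j).toReal * ∑ σ, (p σ).toReal * Φ σ ≤
        ∑ σ, (p σ).toReal * (Φ σ * (if σ.Prefers a j then 1 else 0)) := by
      have h1 := hp.sum_ite_prefers_le hΦ a j hloc htop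
      have h2 : ∑ σ, (p σ).toReal * (Φ σ * (if σ.Prefers a j then 1 else 0)) =
          ∑ σ, (p σ).toReal * Φ σ -
            ∑ σ, (p σ).toReal * (Φ σ * (if σ.Prefers j a then 1 else 0)) := by
        rw [← Finset.sum_sub_distrib]
        refine Finset.sum_congr rfl fun σ _ => ?_
        rcases σ.prefers_or_prefers haJ.1 with h3 | h3
        · simp [h3, h3.asymm]
        · simp [h3, h3.asymm]
      rw [h2]
      have h3 := prefProb_toReal_add p haJ.1
      have h4 : (prefProb p a j).toReal = 1 - (prefProb p j a).toReal := by linarith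
      rw [h4, sub_mul, one_mul]
      linarith
    -- Once `a` has beaten `j`, he is still the top of the chain enlarged by `j`, so the hypotheses
    -- persist for the remaining men.
    have h5 := ih (S := fun σ => insert j (S σ))
      (Φ := fun σ => Φ σ * (if σ.Prefers a j then 1 else 0))
      (fun σ => mul_nonneg (hΦ σ) (by split_ifs <;> norm_num)) ?_ ?_ haJ.2
    · rw [Finset.prod_insert hj]
      calc _ = (∏ j ∈ J, (prefProb p a j).toReal) *
            ((prefProb p a j).toReal * ∑ σ, (p σ).toReal * Φ σ) := by ring
        _ ≤ _ := mul_le_mul_of_nonneg_left hstep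
            (Finset.prod_nonneg fun _ _ => ENNReal.toReal_nonneg)
        _ ≤ _ := h5
        _ = _ := by
          refine Finset.sum_congr rfl fun σ _ => ?_
          by_cases h6 : σ.Prefers a j <;> simp [h6]
    · intro σ τ h
      have h6 := hloc σ τ fun x hx y hy => h x (Or.inr hx) y (Or.inr hy)
      refine ⟨by simp only [h6.1], ?_⟩
      simp only [h6.2]
      by_cases h0 : Φ σ = 0
      · simp [h0]
      · have := h a (Or.inr (htop σ h0).1) j (Or.inl rfl)
        simp [this]
    · intro σ h
      obtain ⟨h6, h7⟩ := mul_ne_zero_iff.1 h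
      have h8 : σ.Prefers a j := by
        by_contra hc; simp [hc] at h7
      refine ⟨Or.inr (htop σ h6).1, fun b hb hba => ?_⟩
      rcases hb with rfl | hb
      · exact h8
      · exact (htop σ h6).2 b hb hba

end Regular

/-! ### Indicators -/

open Classical in
/-- The indicator of a proposition, as a real number. -/
noncomputable def ind (q : Prop) : ℝ := if q then 1 else 0

section Ind

variable {q r : Prop}

theorem ind_nonneg : 0 ≤ ind q := by unfold ind; split_ifs <;> norm_num

theorem ind_le_one : ind q ≤ 1 := by unfold ind; split_ifs <;> norm_num

theorem ind_of (h : q) : ind q = 1 := if_pos h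

theorem ind_of_not (h : ¬ q) : ind q = 0 := if_neg h

theorem ind_ne_zero : ind q ≠ 0 ↔ q := by unfold ind; split_ifs with h <;> simp [h]

theorem ind_mono (h : q → r) : ind q ≤ ind r := by
  by_cases hq : q
  · rw [ind_of hq, ind_of (h hq)]
  · rw [ind_of_not hq]; exact ind_nonneg

theorem ind_and : ind (q ∧ r) = ind q * ind r := by
  by_cases hq : q <;> by_cases hr : r <;> simp [ind, hq, hr]

theorem ind_not : ind (¬ q) = 1 - ind q := by
  by_cases hq : q <;> simp [ind, hq]

theorem sum_ind_le_one {ι : Type*} [Fintype ι] {q : ι → Prop}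
    (h : ∀ i j, q i → q j → i = j) : ∑ i, ind (q i) ≤ 1 := by
  by_cases h' : ∃ i, q i
  · obtain ⟨i, hi⟩ := h'
    rw [Finset.sum_eq_single i (fun j _ hj => ind_of_not fun hq => hj (h j i hq hi))
      (fun hc => absurd (Finset.mem_univ i) hc)]
    exact ind_le_one
  · push Not at h'
    rw [Finset.sum_eq_zero fun i _ => ind_of_not (h' i)]
    exact zero_le_one

end Ind

/-! ### Averages over a finite product -/

section Average

variable {ι α : Type*} [Fintype ι] [DecidableEq ι] [Fintype α]

/-- The average of `F` over independent choices `σ i` with weights `p i`. -/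
noncomputable def productAvg (p : ι → α → ℝ) (F : (ι → α) → ℝ) : ℝ :=
  ∑ σ, (∏ i, p i (σ i)) * F σ

variable {p : ι → α → ℝ} {F G : (ι → α) → ℝ}

theorem productAvg_mono (hp : ∀ i a, 0 ≤ p i a) (h : ∀ σ, F σ ≤ G σ) :
    productAvg p F ≤ productAvg p G :=
  Finset.sum_le_sum fun σ _ =>
    mul_le_mul_of_nonneg_left (h σ) (Finset.prod_nonneg fun _ _ => hp _ _)

theorem productAvg_nonneg (hp : ∀ i a, 0 ≤ p i a) (h : ∀ σ, 0 ≤ F σ) : 0 ≤ productAvg p F :=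
  Finset.sum_nonneg fun σ _ => mul_nonneg (Finset.prod_nonneg fun _ _ => hp _ _) (h σ)

theorem productAvg_add (p : ι → α → ℝ) (F G : (ι → α) → ℝ) :
    productAvg p (fun σ => F σ + G σ) = productAvg p F + productAvg p G := by
  simp [productAvg, mul_add, Finset.sum_add_distrib]

theorem productAvg_sub (p : ι → α → ℝ) (F G : (ι → α) → ℝ) :
    productAvg p (fun σ => F σ - G σ) = productAvg p F - productAvg p G := by
  simp [productAvg, mul_sub, Finset.sum_sub_distrib]

theorem productAvg_sum {κ : Type*} (p : ι → α → ℝ) (s : Finset κ) (F : κ → (ι → α) → ℝ) :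
    productAvg p (fun σ => ∑ k ∈ s, F k σ) = ∑ k ∈ s, productAvg p (F k) := by
  simp only [productAvg, Finset.mul_sum]
  exact Finset.sum_comm

theorem productAvg_const_mul (p : ι → α → ℝ) (c : ℝ) (F : (ι → α) → ℝ) :
    productAvg p (fun σ => c * F σ) = c * productAvg p F := by
  simp only [productAvg, Finset.mul_sum]
  exact Finset.sum_congr rfl fun _ _ => by ring

theorem productAvg_const (hp1 : ∀ i, ∑ a, p i a = 1) (c : ℝ) :
    productAvg p (fun _ => c) = c := by
  simp only [productAvg, ← Finset.sum_mul]
  rw [← Fintype.prod_sum (fun i a => p i a)]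
  simp [hp1]

/-- Exchanging coordinate `w` with an independent fresh copy preserves the product weight. -/
theorem productAvg_resample (hp1 : ∀ i, ∑ a, p i a = 1) (w : ι) (F : (ι → α) → ℝ) :
    productAvg p F = productAvg p fun σ => ∑ τ, p w τ * F (Function.update σ w τ) := by
  let e : (ι → α) × α ≃ (ι → α) × α :=
    { toFun := fun x => (Function.update x.1 w x.2, x.1 w)
      invFun := fun x => (Function.update x.1 w x.2, x.1 w)
      left_inv := fun x => by simp
      right_inv := fun x => by simp }
  have hw : ∀ x : (ι → α) × α, (∏ i, p i ((e x).1 i)) * p w (e x).2 =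
      (∏ i, p i (x.1 i)) * p w x.2 := by
    intro x
    rw [← Finset.mul_prod_erase _ _ (Finset.mem_univ w),
      ← Finset.mul_prod_erase _ (fun i => p i (x.1 i)) (Finset.mem_univ w)]
    have : ∏ i ∈ Finset.univ.erase w, p i ((e x).1 i) =
        ∏ i ∈ Finset.univ.erase w, p i (x.1 i) := by
      refine Finset.prod_congr rfl fun i hi => ?_
      have hne := Finset.ne_of_mem_erase hi
      simp [e, Function.update_of_ne hne]
    rw [this]
    simp only [e, Equiv.coe_fn_mk, Function.update_self]
    ring
  have h1 := e.sum_comp fun x => ((∏ i, p i (x.1 i)) * p w x.2) * F x.1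
  simp only [hw] at h1
  rw [Fintype.sum_prod_type, Fintype.sum_prod_type] at h1
  symm
  calc _ = ∑ σ, ∑ τ, ((∏ i, p i (σ i)) * p w τ) * F (Function.update σ w τ) := by
        simp only [productAvg, Finset.mul_sum, mul_assoc]
    _ = ∑ σ, ∑ τ, ((∏ i, p i (σ i)) * p w τ) * F σ := h1
    _ = _ := by
        refine Finset.sum_congr rfl fun σ _ => ?_
        rw [← Finset.sum_mul, ← Finset.mul_sum, hp1, mul_one]

theorem productAvg_le_of_resample (hp : ∀ i a, 0 ≤ p i a) (hp1 : ∀ i, ∑ a, p i a = 1) (w : ι)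
    (h : ∀ σ, ∑ τ, p w τ * F (Function.update σ w τ) ≤
      ∑ τ, p w τ * G (Function.update σ w τ)) : productAvg p F ≤ productAvg p G := by
  rw [productAvg_resample hp1 w F, productAvg_resample hp1 w G]
  exact productAvg_mono hp h

/-- Factors can be replaced one coordinate at a time. -/
theorem productAvg_prod_le {Loc : ι → ((ι → α) → ℝ) → Prop}
    (hmul : ∀ w f g, Loc w f → Loc w g → Loc w fun σ => f σ * g σ)
    {X Y : ι → (ι → α) → ℝ} (hX0 : ∀ w σ, 0 ≤ X w σ) (hY0 : ∀ w σ, 0 ≤ Y w σ)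
    (hX : ∀ w w', w ≠ w' → Loc w' (X w)) (hY : ∀ w w', w ≠ w' → Loc w' (Y w))
    (hstep : ∀ w (Φ : (ι → α) → ℝ), (∀ σ, 0 ≤ Φ σ) → Loc w Φ →
      productAvg p (fun σ => Φ σ * X w σ) ≤ productAvg p fun σ => Φ σ * Y w σ)
    (A : Finset ι) : ∀ Φ : (ι → α) → ℝ, (∀ σ, 0 ≤ Φ σ) → (∀ w ∈ A, Loc w Φ) →
      productAvg p (fun σ => Φ σ * ∏ w ∈ A, X w σ) ≤
        productAvg p fun σ => Φ σ * ∏ w ∈ A, Y w σ := by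
  induction A using Finset.induction_on with
  | empty => intro Φ _ _; simp
  | insert w A hw ih =>
    intro Φ hΦ hloc
    have h1 := ih (fun σ => Φ σ * X w σ) (fun σ => mul_nonneg (hΦ σ) (hX0 w σ))
      (fun w' hw' => hmul _ _ _ (hloc w' (Finset.mem_insert_of_mem hw'))
        (hX w w' (by rintro rfl; exact hw hw')))
    -- The factors already replaced belong to other coordinates, so together with `Φ` they remain
    -- admissible for the replacement at `w`.
    have hB : ∀ B : Finset ι, w ∉ B → Loc w fun σ => Φ σ * ∏ w ∈ B, Y w σ := by
      intro B
      induction B using Finset.induction_on with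
      | empty => intro _; simpa using hloc w (Finset.mem_insert_self _ _)
      | insert v B hv ihB =>
        intro hwB
        rw [Finset.mem_insert, not_or] at hwB
        have := hmul _ _ _ (ihB hwB.2) (hY v w (Ne.symm hwB.1))
        convert this using 2 with σ
        rw [Finset.prod_insert hv]; ring
    have h2 := hstep w (fun σ => Φ σ * ∏ w ∈ A, Y w σ)
      (fun σ => mul_nonneg (hΦ σ) (Finset.prod_nonneg fun _ _ => hY0 _ _)) (hB A hw)
    simp only [Finset.prod_insert hw]
    calc _ = productAvg p fun σ => Φ σ * X w σ * ∏ w ∈ A, X w σ := by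
          congr 1; ext σ; ring
      _ ≤ _ := h1
      _ = productAvg p fun σ => Φ σ * (∏ w ∈ A, Y w σ) * X w σ := by
          congr 1; ext σ; ring
      _ ≤ _ := h2
      _ = _ := by congr 1; ext σ; ring

end Average

/-! ### Geometric odds and their sums -/

/-- Regular distributions for which a person prefers number `j` to an earlier number `x` with
geometrically small probability. -/
structure GeometricOdds {M W : ℕ} (p : Fin W → PMF (PrefList M)) (A b : ℝ) : Prop where
  regular : ∀ w, IsRegularPref (p w)
  A_nonneg : 0 ≤ A
  b_pos : 0 < b
  b_lt_one : b < 1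
  upper : ∀ w (x j : Fin M), x < j → (prefProb (p w) j x).toReal ≤ A * b ^ ((j : ℕ) - x)
  lower : ∀ w (x j : Fin M), x < j →
    Real.exp (-(A * b ^ ((j : ℕ) - x))) ≤ (prefProb (p w) x j).toReal

/-- Let `U = A * b ^ k`. The probability that `j` beats `x` is at most `U` times that of the
converse, hence at most `U`. As the two add up to `1`, the converse has probability at least `1 / (1
+ U)`, which is at least `exp (-U)`. -/
theorem geometricOdds_of_maxOdds {M W : ℕ} {p : Fin W → PMF (PrefList M)} {A c : ℝ}
    (hA : 0 < A) (hc : 0 < c) (hreg : ∀ w, IsRegularPref (p w))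
    (h : ∀ k : ℕ, 1 ≤ k → maxOdds p k ≤ ENNReal.ofReal (A * Real.exp (-(c * k)))) :
    GeometricOdds p A (Real.exp (-c)) := by
  have key : ∀ w (x j : Fin M), x < j → (prefProb (p w) j x).toReal ≤
      A * Real.exp (-c) ^ ((j : ℕ) - x) * (prefProb (p w) x j).toReal := by
    intro w x j hxj
    have hk : (x : ℕ) < j := hxj
    set k := (j : ℕ) - x with hkdef
    have hb : A * Real.exp (-c) ^ k = A * Real.exp (-(c * k)) := by
      rw [← Real.exp_nat_mul]; ring_nf
    have h1 : prefProb (p w) j x / prefProb (p w) x j ≤ maxOdds p k := by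
      unfold maxOdds
      refine le_iSup_of_le w (le_iSup_of_le x (le_iSup_of_le j (le_iSup_of_le (by omega) le_rfl)))
    have h2 := h1.trans (h k (by omega))
    have hsum := prefProb_toReal_add (p w) hxj.ne
    have h0 : prefProb (p w) x j ≠ 0 := by
      intro h0
      rw [h0] at h2 hsum
      have h3 : prefProb (p w) j x ≠ 0 := by
        intro h3; rw [h3] at hsum; simp at hsum
      rw [ENNReal.div_zero h3] at h2
      exact ENNReal.ofReal_ne_top (top_le_iff.1 h2)
    have h3 := (ENNReal.div_le_iff h0 (toOuterMeasure_ne_top _ _)).1 h2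
    have h4 := ENNReal.toReal_mono
      (ENNReal.mul_ne_top ENNReal.ofReal_ne_top (toOuterMeasure_ne_top _ _)) h3
    rwa [ENNReal.toReal_mul, ENNReal.toReal_ofReal (by positivity), ← hb] at h4
  refine ⟨hreg, hA.le, Real.exp_pos _, by simpa using hc, fun w x j hxj => ?_,
    fun w x j hxj => ?_⟩
  all_goals
    have h1 := key w x j hxj
    have hsum := prefProb_toReal_add (p w) hxj.ne
    have hx0 : 0 ≤ (prefProb (p w) x j).toReal := ENNReal.toReal_nonneg
    have hj0 : 0 ≤ (prefProb (p w) j x).toReal := ENNReal.toReal_nonneg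
    have hU : 0 ≤ A * Real.exp (-c) ^ ((j : ℕ) - x) := by positivity
    generalize A * Real.exp (-c) ^ ((j : ℕ) - x) = U at *
  · nlinarith
  · have h2 := Real.add_one_le_exp U
    rw [Real.exp_neg, inv_le_iff_one_le_mul₀ (Real.exp_pos _)]
    nlinarith

theorem sum_pow_le_of_injOn {ι : Type*} {b : ℝ} (hb0 : 0 ≤ b) (hb1 : b < 1) (s : Finset ι)
    (f : ι → ℕ) (hf : Set.InjOn f s) : ∑ i ∈ s, b ^ f i ≤ 1 / (1 - b) := by
  classical
  rw [← Finset.sum_image (f := fun k => b ^ k) hf, one_div, ← tsum_geometric_of_lt_one hb0 hb1]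
  exact (summable_geometric_of_lt_one hb0 hb1).sum_le_tsum _ fun _ _ => by positivity

/-- The exponent splits as `j - x = d + (u - x) + (j - (u + d))`, leaving two independent geometric
sums. -/
theorem sum_sum_pow_le {A b : ℝ} (hA : 0 ≤ A) (hb0 : 0 ≤ b) (hb1 : b < 1) (M u d : ℕ) :
    ∑ x ∈ Finset.univ.filter (fun x : Fin M => (x : ℕ) < u),
      ∑ j ∈ Finset.univ.filter (fun j : Fin M => u + d ≤ (j : ℕ)), A * b ^ ((j : ℕ) - x) ≤
      A / (1 - b) ^ 2 * b ^ d := by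
  have h1 : ∀ x ∈ Finset.univ.filter (fun x : Fin M => (x : ℕ) < u),
      ∑ j ∈ Finset.univ.filter (fun j : Fin M => u + d ≤ (j : ℕ)), A * b ^ ((j : ℕ) - x) ≤
        A * b ^ d * b ^ (u - x) * (1 / (1 - b)) := by
    intro x hx
    have hx' := (Finset.mem_filter.1 hx).2
    refine le_trans (le_of_eq ?_) (mul_le_mul_of_nonneg_left (sum_pow_le_of_injOn hb0 hb1
      (Finset.univ.filter fun j : Fin M => u + d ≤ (j : ℕ)) (fun j => (j : ℕ) - (u + d)) ?_)
      (by positivity))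
    · rw [Finset.mul_sum]
      refine Finset.sum_congr rfl fun j hj => ?_
      have hj' := (Finset.mem_filter.1 hj).2
      have : (j : ℕ) - x = d + (u - x) + (j - (u + d)) := by omega
      rw [this, pow_add, pow_add]; ring
    · intro i hi j hj e
      have hi' := (Finset.mem_filter.1 hi).2
      have hj' := (Finset.mem_filter.1 hj).2
      exact Fin.ext (by simp only at e; omega)
  refine (Finset.sum_le_sum h1).trans ?_
  rw [← Finset.sum_mul, ← Finset.mul_sum]
  have h2 := sum_pow_le_of_injOn hb0 hb1 (Finset.univ.filter fun x : Fin M => (x : ℕ) < u)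
    (fun x => u - (x : ℕ)) (fun i hi j hj e => by
      have hi' := (Finset.mem_filter.1 hi).2
      have hj' := (Finset.mem_filter.1 hj).2
      exact Fin.ext (by simp only at e; omega))
  have h3 : 0 < 1 - b := by linarith
  calc _ ≤ A * b ^ d * (1 / (1 - b)) * (1 / (1 - b)) := by gcongr
    _ = _ := by field_simp

/-! ### Which parts of the women's lists the procedure reads -/

namespace Profile

variable {M W : ℕ} {ms : Fin M → PrefList W} {ws : Fin W → PrefList M}
  {t u : ℕ} {w : Fin W} {τ : PrefList M}

/-- Changing the list of `w` without affecting the comparisons between her proposers does not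
change the proposals. -/
theorem proposes_update (h : PrefList.AgreeOn {m | Proposes (ms, ws) u m w} (ws w) τ) (m : Fin M)
    (w' : Fin W) :
    Proposes (ms, Function.update ws w τ) u m w' ↔ Proposes (ms, ws) u m w' := by
  refine (proposes_congr (P := (ms, ws)) (Q := (ms, Function.update ws w τ)) (fun _ _ => rfl) fun v => ?_).symm
  by_cases e : v = w
  · subst e; simpa using h
  · simpa [Function.update_of_ne e] using PrefList.AgreeOn.refl _ _

theorem agreeOn_of_notMem_reached (h : w ∉ reached (ms, ws) u) :
    PrefList.AgreeOn {m | Proposes (ms, ws) u m w} (ws w) τ :=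
  fun a ha => absurd (mem_reached.2 ⟨a, ha⟩) h

theorem agreeOn_mono (htu : t ≤ u)
    (h : PrefList.AgreeOn {m | Proposes (ms, ws) u m w} (ws w) τ) :
    PrefList.AgreeOn {m | Proposes (ms, ws) t m w} (ws w) τ :=
  fun a ha b hb => h a (Proposes.mono htu ha) b (Proposes.mono htu hb)

theorem reached_update (h : PrefList.AgreeOn {m | Proposes (ms, ws) u m w} (ws w) τ) :
    reached (ms, Function.update ws w τ) u = reached (ms, ws) u := by
  ext v
  simp only [mem_reached, proposes_update h]

theorem holds_update (h : PrefList.AgreeOn {m | Proposes (ms, ws) u m w} (ws w) τ) (m : Fin M)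
    (w' : Fin W) : Holds (ms, Function.update ws w τ) u m w' ↔ Holds (ms, ws) u m w' := by
  simp only [Holds, proposes_update h]
  refine and_congr_right fun hm => ?_
  by_cases e : w' = w
  · subst e
    simp only [Function.update_self]
    exact forall_congr' fun y => forall_congr' fun hy => forall_congr' fun _ => (h m hm y hy).symm
  · simp [Function.update_of_ne e]

/-- An unreached woman holds nobody, and her list is not consulted. -/
theorem secure_update (h : w ∉ reached (ms, ws) u) (v : ℕ) :
    Secure (ms, Function.update ws w τ) u v ↔ Secure (ms, ws) u v := by
  simp only [Secure, holds_update (agreeOn_of_notMem_reached h)]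
  refine forall_congr' fun m => forall_congr' fun w' => forall_congr' fun hh => ?_
  have hne : w' ≠ w := by
    rintro rfl
    exact h (mem_reached.2 ⟨m, hh.1⟩)
  simp [Function.update_of_ne hne]

/-- `Φ` depends on the list of `w` at most through the comparisons between the proposers of `w`
among the first `u` men, if no one of the first `t` men has proposed to her. -/
def IsLocal (ms : Fin M → PrefList W) (t u : ℕ) (w : Fin W)
    (Φ : (Fin W → PrefList M) → ℝ) : Prop :=
  ∀ ws τ, w ∉ reached (ms, ws) t →
    PrefList.AgreeOn {m | Proposes (ms, ws) u m w} (ws w) τ →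
    Φ (Function.update ws w τ) = Φ ws

/-- `Φ` does not depend on the lists of the women not reached by the first `t` men. -/
def IsAdapted (ms : Fin M → PrefList W) (t : ℕ) (Φ : (Fin W → PrefList M) → ℝ) : Prop :=
  ∀ w ws τ, w ∉ reached (ms, ws) t → Φ (Function.update ws w τ) = Φ ws

variable {Φ Ψ : (Fin W → PrefList M) → ℝ}

theorem IsLocal.mul (hΦ : IsLocal ms t u w Φ) (hΨ : IsLocal ms t u w Ψ) :
    IsLocal ms t u w fun ws => Φ ws * Ψ ws :=
  fun ws τ h h' => by simp only [hΦ ws τ h h', hΨ ws τ h h']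

theorem IsAdapted.isLocal (h : IsAdapted ms t Φ) (u : ℕ) (w : Fin W) : IsLocal ms t u w Φ :=
  fun ws τ h' _ => h w ws τ h'

theorem IsAdapted.mono (htu : t ≤ u) (h : IsAdapted ms t Φ) : IsAdapted ms u Φ :=
  fun w ws τ h' => h w ws τ fun hc => h' (reached_mono htu hc)

theorem IsAdapted.mul (hΦ : IsAdapted ms t Φ) (hΨ : IsAdapted ms t Ψ) :
    IsAdapted ms t fun ws => Φ ws * Ψ ws :=
  fun w ws τ h => by simp only [hΦ w ws τ h, hΨ w ws τ h]

theorem isAdapted_ind {q : (Fin W → PrefList M) → Prop}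
    (h : ∀ w ws τ, w ∉ reached (ms, ws) t → (q (Function.update ws w τ) ↔ q ws)) :
    IsAdapted ms t fun ws => ind (q ws) :=
  fun w ws τ h' => by simp only [h w ws τ h']

theorem isAdapted_secure (ms : Fin M → PrefList W) (u v : ℕ) :
    IsAdapted ms u fun ws => ind (Secure (ms, ws) u v) :=
  isAdapted_ind fun _ _ _ h => secure_update h v

/-- The average over the lists of the women. -/
noncomputable def womenAvg (p : Fin W → PMF (PrefList M)) (F : (Fin W → PrefList M) → ℝ) : ℝ :=
  productAvg (fun w τ => (p w τ).toReal) F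

variable {p : Fin W → PMF (PrefList M)} {A b : ℝ}

theorem womenAvg_mono {F G : (Fin W → PrefList M) → ℝ} (h : ∀ ws, F ws ≤ G ws) :
    womenAvg p F ≤ womenAvg p G := productAvg_mono (fun _ _ => ENNReal.toReal_nonneg) h

theorem womenAvg_nonneg {F : (Fin W → PrefList M) → ℝ} (h : ∀ ws, 0 ≤ F ws) :
    0 ≤ womenAvg p F := productAvg_nonneg (fun _ _ => ENNReal.toReal_nonneg) h

theorem womenAvg_le_of_resample {F G : (Fin W → PrefList M) → ℝ} (w : Fin W)
    (h : ∀ ws, ∑ τ, (p w τ).toReal * F (Function.update ws w τ) ≤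
      ∑ τ, (p w τ).toReal * G (Function.update ws w τ)) : womenAvg p F ≤ womenAvg p G :=
  productAvg_le_of_resample (fun _ _ => ENNReal.toReal_nonneg) (fun w => sum_toReal_pmf (p w)) w h

/-- The hypotheses of the one-list estimates, for the list of a woman who has not been reached. -/
theorem IsLocal.section_local (hloc : IsLocal ms t u w Φ)
    (hw : w ∉ reached (ms, ws) t) (x : Fin M) (σ τ : PrefList M)
    (h : PrefList.AgreeOn {m | Proposes (ms, Function.update ws w σ) u m w} σ τ) :
    {m | Proposes (ms, Function.update ws w τ) u m w} =
        {m | Proposes (ms, Function.update ws w σ) u m w} ∧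
      Φ (Function.update ws w τ) * ind (Holds (ms, Function.update ws w τ) u x w) =
        Φ (Function.update ws w σ) * ind (Holds (ms, Function.update ws w σ) u x w) := by
  have h' : PrefList.AgreeOn {m | Proposes (ms, Function.update ws w σ) u m w}
      (Function.update ws w σ w) τ := by simpa using h
  have hw' : w ∉ reached (ms, Function.update ws w σ) t := by
    rwa [reached_update (agreeOn_of_notMem_reached hw)]
  have e : Function.update ws w τ = Function.update (Function.update ws w σ) w τ := by simp
  rw [e]
  refine ⟨Set.ext fun m => proposes_update h' m w, ?_⟩
  rw [hloc _ τ hw' h']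
  simp only [holds_update h']

theorem section_top (x : Fin M) (σ : PrefList M)
    (h : Φ (Function.update ws w σ) * ind (Holds (ms, Function.update ws w σ) u x w) ≠ 0) :
    x ∈ {m | Proposes (ms, Function.update ws w σ) u m w} ∧
      ∀ y ∈ {m | Proposes (ms, Function.update ws w σ) u m w}, y ≠ x → σ.Prefers x y := by
  have h1 := ind_ne_zero.1 (right_ne_zero_of_mul h)
  refine ⟨h1.1, fun y hy hne => ?_⟩
  simpa using h1.2 y hy hne

/-- All lists but that of `w` are frozen and hers is resampled. Whether she is reached by the first
`t` men does not change; if she is not, her proposers form the revealed set of the one-list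
estimate, with `x` on top. -/
theorem womenAvg_prefers_le (hreg : ∀ w, IsRegularPref (p w)) (hΦ : ∀ ws, 0 ≤ Φ ws)
    (hloc : IsLocal ms t u w Φ) (x j : Fin M) :
    womenAvg p (fun ws => Φ ws * ind (w ∉ reached (ms, ws) t) * ind (Holds (ms, ws) u x w) *
        ind ((ws w).Prefers j x)) ≤
      (prefProb (p w) j x).toReal * womenAvg p (fun ws =>
        Φ ws * ind (w ∉ reached (ms, ws) t) * ind (Holds (ms, ws) u x w)) := by
  rw [womenAvg, womenAvg, ← productAvg_const_mul]
  refine womenAvg_le_of_resample w fun ws => ?_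
  by_cases hw : w ∈ reached (ms, ws) t
  · have : ∀ τ, w ∈ reached (ms, Function.update ws w τ) t := by
      intro τ
      by_contra hc
      have := reached_update (ms := ms) (u := t) (τ := ws w) (agreeOn_of_notMem_reached hc)
      simp only [Function.update_idem, Function.update_eq_self] at this
      rw [this] at hw
      exact hc hw
    refine le_of_eq ?_
    simp [ind, this]
  have hnot : ∀ τ, w ∉ reached (ms, Function.update ws w τ) t := fun τ => by
    rwa [reached_update (agreeOn_of_notMem_reached hw)]
  have := (hreg w).sum_ite_prefers_le
    (S := fun σ => {m | Proposes (ms, Function.update ws w σ) u m w})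
    (Φ := fun σ => Φ (Function.update ws w σ) * ind (Holds (ms, Function.update ws w σ) u x w))
    (fun σ => mul_nonneg (hΦ _) ind_nonneg) x j
    (fun σ τ h => hloc.section_local hw x σ τ h) (fun σ h => section_top x σ h)
  rw [Finset.mul_sum] at this
  simp only [ind_of (hnot _), mul_one, Function.update_self]
  refine (le_of_eq ?_).trans (this.trans (le_of_eq ?_))
  · rfl
  · exact Finset.sum_congr rfl fun _ _ => by ring

end Profile

/-! ### Probability that a level is secure -/

namespace Profile

variable {M W : ℕ} {ms : Fin M → PrefList W} {ws : Fin W → PrefList M}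
  {t u : ℕ} {w : Fin W} {τ : PrefList M} {Φ Ψ : (Fin W → PrefList M) → ℝ}
  {p : Fin W → PMF (PrefList M)} {A b : ℝ}

theorem notMem_reached_update (hw : w ∉ reached (ms, ws) t) (τ : PrefList M) :
    w ∉ reached (ms, Function.update ws w τ) t := by
  rwa [reached_update (agreeOn_of_notMem_reached hw)]

theorem mem_reached_update (hw : w ∈ reached (ms, ws) t) (τ : PrefList M) :
    w ∈ reached (ms, Function.update ws w τ) t := by
  by_contra hc
  have := notMem_reached_update hc (ws w)
  simp only [Function.update_idem, Function.update_eq_self] at this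
  exact this hw

/-- If the men reached so far are secure from level `u` on, it is unlikely that the first `u`
men are not secure from level `u + d` on. -/
theorem womenAvg_not_secure_le (hp : GeometricOdds p A b) (htu : t ≤ u) (hΨ0 : ∀ ws, 0 ≤ Ψ ws)
    (hΨ : IsAdapted ms t Ψ) (hsup : ∀ ws, Ψ ws ≠ 0 → Secure (ms, ws) t u) (d : ℕ) :
    womenAvg p (fun ws => Ψ ws * ind (¬ Secure (ms, ws) u (u + d))) ≤
      A / (1 - b) ^ 2 * b ^ d * womenAvg p Ψ := by
  classical
  set X := Finset.univ.filter (fun x : Fin M => (x : ℕ) < u) with hX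
  set J := Finset.univ.filter (fun j : Fin M => u + d ≤ (j : ℕ)) with hJ
  have hpt : ∀ ws, Ψ ws * ind (¬ Secure (ms, ws) u (u + d)) ≤ ∑ w : Fin W, ∑ x ∈ X, ∑ j ∈ J,
      Ψ ws * ind (w ∉ reached (ms, ws) t) * ind (Holds (ms, ws) u x w) *
        ind ((ws w).Prefers j x) := by
    intro ws
    have hnn : ∀ w x j, 0 ≤ Ψ ws * ind (w ∉ reached (ms, ws) t) * ind (Holds (ms, ws) u x w) *
        ind ((ws w).Prefers j x) := fun w x j =>
      mul_nonneg (mul_nonneg (mul_nonneg (hΨ0 ws) ind_nonneg) ind_nonneg) ind_nonneg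
    by_cases h0 : Ψ ws = 0
    · rw [h0, zero_mul]
      simp
    by_cases hs : Secure (ms, ws) u (u + d)
    · rw [ind_of_not (not_not.2 hs), mul_zero]
      exact Finset.sum_nonneg fun w _ => Finset.sum_nonneg fun x _ => Finset.sum_nonneg
        fun j _ => hnn w x j
    have hs' := hs
    simp only [Secure] at hs'
    push Not at hs'
    obtain ⟨x, w, hxw, j, hj, hnj⟩ := hs'
    have hxu : (x : ℕ) < u := hxw.1.lt
    have hne : x ≠ j := by rintro rfl; omega
    have hjx : (ws w).Prefers j x := (PrefList.not_prefers_iff hne).1 hnj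
    -- A woman reached by the first `t` men already held someone better than all men from `u` on,
    -- and the man she holds can only improve.
    have hw : w ∉ reached (ms, ws) t := by
      intro hw
      obtain ⟨y, hy⟩ := mem_reached_iff_holds.1 hw
      have h1 : (ws w).Prefers y j := hsup ws h0 y w hy j (by omega)
      rcases hy.mono_prefers htu hxw with rfl | h2
      · exact hnj h1
      · exact hnj (PrefList.Prefers.trans h2 h1)
    have h1 := Finset.single_le_sum (f := fun w => ∑ x ∈ X, ∑ j ∈ J,
      Ψ ws * ind (w ∉ reached (ms, ws) t) * ind (Holds (ms, ws) u x w) *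
        ind ((ws w).Prefers j x)) (fun w _ => Finset.sum_nonneg fun x _ => Finset.sum_nonneg
        fun j _ => hnn w x j) (Finset.mem_univ w)
    have h2 := Finset.single_le_sum (f := fun x => ∑ j ∈ J,
      Ψ ws * ind (w ∉ reached (ms, ws) t) * ind (Holds (ms, ws) u x w) *
        ind ((ws w).Prefers j x)) (fun x _ => Finset.sum_nonneg fun j _ => hnn w x j)
        (show x ∈ X by simp [hX, hxu])
    have h3 := Finset.single_le_sum (f := fun j =>
      Ψ ws * ind (w ∉ reached (ms, ws) t) * ind (Holds (ms, ws) u x w) *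
        ind ((ws w).Prefers j x)) (fun j _ => hnn w x j)
        (show j ∈ J by simp [hJ, hj])
    refine le_trans (le_of_eq ?_) ((h3.trans h2).trans h1)
    simp only [ind_of hs, ind_of hw, ind_of hxw, ind_of hjx, mul_one]
  have hb0 := hp.b_pos.le
  have hterm : ∀ w, ∀ x ∈ X, ∀ j ∈ J, womenAvg p (fun ws => Ψ ws * ind (w ∉ reached (ms, ws) t) *
      ind (Holds (ms, ws) u x w) * ind ((ws w).Prefers j x)) ≤
      A * b ^ ((j : ℕ) - x) * womenAvg p (fun ws => Ψ ws * ind (Holds (ms, ws) u x w)) := by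
    intro w x hx j hj
    have hxj : x < j := by
      have h1 := (Finset.mem_filter.1 hx).2
      have h2 := (Finset.mem_filter.1 hj).2
      exact Fin.lt_def.2 (by omega)
    refine (womenAvg_prefers_le hp.regular hΨ0 (hΨ.isLocal u w) x j).trans ?_
    refine mul_le_mul (hp.upper w x j hxj) (womenAvg_mono fun ws => ?_)
      (womenAvg_nonneg fun ws => mul_nonneg (mul_nonneg (hΨ0 ws) ind_nonneg) ind_nonneg)
      (mul_nonneg hp.A_nonneg (pow_nonneg hb0 _))
    exact mul_le_mul_of_nonneg_right (mul_le_of_le_one_right (hΨ0 ws) ind_le_one) ind_nonneg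
  -- Each man is held by at most one woman, so the union bound over women costs nothing.
  have hw1 : ∀ x : Fin M, ∑ w : Fin W, womenAvg p (fun ws => Ψ ws * ind (Holds (ms, ws) u x w)) ≤
      womenAvg p Ψ := by
    intro x
    simp only [womenAvg]
    rw [← productAvg_sum]
    refine womenAvg_mono fun ws => ?_
    rw [← Finset.mul_sum]
    exact mul_le_of_le_one_right (hΨ0 ws) (sum_ind_le_one fun _ _ h h' => h.woman_unique h')
  calc _ ≤ womenAvg p (fun ws => ∑ w : Fin W, ∑ x ∈ X, ∑ j ∈ J,
        Ψ ws * ind (w ∉ reached (ms, ws) t) * ind (Holds (ms, ws) u x w) *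
          ind ((ws w).Prefers j x)) := womenAvg_mono hpt
    _ = ∑ w : Fin W, ∑ x ∈ X, ∑ j ∈ J, womenAvg p (fun ws =>
        Ψ ws * ind (w ∉ reached (ms, ws) t) * ind (Holds (ms, ws) u x w) *
          ind ((ws w).Prefers j x)) := by
        simp only [womenAvg, productAvg_sum]
    _ ≤ ∑ w : Fin W, ∑ x ∈ X, ∑ j ∈ J, A * b ^ ((j : ℕ) - x) *
        womenAvg p (fun ws => Ψ ws * ind (Holds (ms, ws) u x w)) :=
      Finset.sum_le_sum fun w _ => Finset.sum_le_sum fun x hx => Finset.sum_le_sum fun j hj =>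
        hterm w x hx j hj
    _ = ∑ x ∈ X, (∑ j ∈ J, A * b ^ ((j : ℕ) - x)) *
        ∑ w : Fin W, womenAvg p (fun ws => Ψ ws * ind (Holds (ms, ws) u x w)) := by
      rw [Finset.sum_comm]
      refine Finset.sum_congr rfl fun x _ => ?_
      rw [Finset.sum_mul_sum, Finset.sum_comm]
    _ ≤ ∑ x ∈ X, (∑ j ∈ J, A * b ^ ((j : ℕ) - x)) * womenAvg p Ψ :=
      Finset.sum_le_sum fun x _ => mul_le_mul_of_nonneg_left (hw1 x) (Finset.sum_nonneg
        fun j _ => mul_nonneg hp.A_nonneg (pow_nonneg hb0 _))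
    _ ≤ _ := by
      rw [← Finset.sum_mul]
      exact mul_le_mul_of_nonneg_right (sum_sum_pow_le hp.A_nonneg hb0 hp.b_lt_one M u d)
        (womenAvg_nonneg hΨ0)

/-- The total weight of the men who could be preferred to `x` from level `u` on. -/
noncomputable def oddsTail (A b : ℝ) (M u : ℕ) (x : Fin M) : ℝ :=
  ∑ j ∈ Finset.univ.filter (fun j : Fin M => u ≤ (j : ℕ)), A * b ^ ((j : ℕ) - x)

theorem _root_.GeometricOdds.exp_neg_oddsTail_le (hp : GeometricOdds p A b) (w : Fin W)
    {x : Fin M} (hx : (x : ℕ) < u) : Real.exp (-oddsTail A b M u x) ≤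
      ∏ j ∈ Finset.univ.filter (fun j : Fin M => u ≤ (j : ℕ)), (prefProb (p w) x j).toReal := by
  rw [oddsTail, ← Finset.sum_neg_distrib, Real.exp_sum]
  refine Finset.prod_le_prod (fun _ _ => (Real.exp_pos _).le) fun j hj => ?_
  have h2 := (Finset.mem_filter.1 hj).2
  exact hp.lower w x j (Fin.lt_def.2 (by omega))

theorem oddsTail_nonneg (hA : 0 ≤ A) (hb : 0 ≤ b) (x : Fin M) : 0 ≤ oddsTail A b M u x :=
  Finset.sum_nonneg fun _ _ => mul_nonneg hA (pow_nonneg hb _)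

theorem sum_oddsTail_le (hp : GeometricOdds p A b) :
    ∑ x ∈ Finset.univ.filter (fun x : Fin M => (x : ℕ) < u), oddsTail A b M u x ≤
      A / (1 - b) ^ 2 := by
  simpa [oddsTail] using sum_sum_pow_le hp.A_nonneg hp.b_pos.le hp.b_lt_one M u 0

theorem oddsTail_le (hp : GeometricOdds p A b) {x : Fin M} (hx : (x : ℕ) < u) :
    oddsTail A b M u x ≤ A / (1 - b) ^ 2 :=
  (Finset.single_le_sum (f := fun x => oddsTail A b M u x)
    (fun x _ => oddsTail_nonneg hp.A_nonneg hp.b_pos.le x)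
    (Finset.mem_filter.2 ⟨Finset.mem_univ x, hx⟩)).trans (sum_oddsTail_le hp)

/-- One-list estimate for the event that the man held by `w` beats everyone from level `u` on. -/
theorem sum_exp_mul_le (hp : GeometricOdds p A b) (hΦ : ∀ ws, 0 ≤ Φ ws)
    (hloc : IsLocal ms t u w Φ) (hw : w ∉ reached (ms, ws) t) {x : Fin M} (hx : (x : ℕ) < u) :
    Real.exp (-oddsTail A b M u x) * ∑ σ, (p w σ).toReal *
        (Φ (Function.update ws w σ) * ind (Holds (ms, Function.update ws w σ) u x w)) ≤
      ∑ σ, (p w σ).toReal *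
        (Φ (Function.update ws w σ) * ind (Holds (ms, Function.update ws w σ) u x w) *
          ind (∀ j : Fin M, u ≤ (j : ℕ) → σ.Prefers x j)) := by
  have := (hp.regular w).prod_mul_sum_le (a := x)
    (Finset.univ.filter (fun j : Fin M => u ≤ (j : ℕ)))
    (S := fun σ => {m | Proposes (ms, Function.update ws w σ) u m w})
    (Φ := fun σ => Φ (Function.update ws w σ) * ind (Holds (ms, Function.update ws w σ) u x w))
    (fun σ => mul_nonneg (hΦ _) ind_nonneg)
    (fun σ τ h => hloc.section_local hw x σ τ h) (fun σ h => section_top x σ h)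
    (by simpa using hx)
  refine (mul_le_mul_of_nonneg_right (hp.exp_neg_oddsTail_le w hx) (Finset.sum_nonneg
    fun σ _ => mul_nonneg ENNReal.toReal_nonneg (mul_nonneg (hΦ _) ind_nonneg))).trans
    (this.trans (le_of_eq ?_))
  refine Finset.sum_congr rfl fun σ _ => ?_
  have e : (∀ j ∈ Finset.univ.filter (fun j : Fin M => u ≤ (j : ℕ)), σ.Prefers x j) ↔
      ∀ j : Fin M, u ≤ (j : ℕ) → σ.Prefers x j := by simp
  by_cases h : ∀ j : Fin M, u ≤ (j : ℕ) → σ.Prefers x j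
  · rw [ind_of h, if_pos (e.2 h)]
  · rw [ind_of_not h, if_neg fun h' => h (e.1 h')]

theorem sum_ind_holds_mul {P : Profile M W} (f : Fin M → ℝ) {x : Fin M}
    (hx : P.Holds u x w) : ∑ y, ind (P.Holds u y w) * f y = f x := by
  rw [Finset.sum_eq_single x, ind_of hx, one_mul]
  · intro y _ hne
    rw [ind_of_not fun hc => hne (hc.man_unique hx), zero_mul]
  · exact fun hc => absurd (Finset.mem_univ x) hc

/-- With probability bounded from below, level `u` is secure. -/
theorem le_womenAvg_secure (hp : GeometricOdds p A b) (htu : t ≤ u) (hΨ0 : ∀ ws, 0 ≤ Ψ ws)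
    (hΨ : IsAdapted ms t Ψ) (hsup : ∀ ws, Ψ ws ≠ 0 → Secure (ms, ws) t u) :
    Real.exp (-(A / (1 - b) ^ 2)) * womenAvg p Ψ ≤
      womenAvg p fun ws => Ψ ws * ind (Secure (ms, ws) u u) := by
  classical
  let β := oddsTail A b M u
  -- `X w` says that `w` does not spoil security; women reached by the first `t` men never do, by
  -- `hsup`. `Y w` is the guaranteed conditional probability, depending on the man held, by which `X
  -- w` is replaced one woman at a time.
  let X : Fin W → (Fin W → PrefList M) → ℝ := fun w ws => ind (w ∈ reached (ms, ws) t ∨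
    ∀ x, Holds (ms, ws) u x w → ∀ j : Fin M, u ≤ (j : ℕ) → (ws w).Prefers x j)
  let Y : Fin W → (Fin W → PrefList M) → ℝ := fun w ws =>
    Real.exp (-∑ x, ind (Holds (ms, ws) u x w) * β x)
  have hβ : ∀ x, 0 ≤ β x := oddsTail_nonneg hp.A_nonneg hp.b_pos.le
  have hY1 : ∀ w ws, Y w ws ≤ 1 := fun w ws => Real.exp_le_one_iff.2 (neg_nonpos.2
    (Finset.sum_nonneg fun x _ => mul_nonneg ind_nonneg (hβ x)))
  have hXloc : ∀ w w', w ≠ w' → IsLocal ms t u w' (X w) := by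
    intro w w' hne ws τ h h'
    simp only [X, holds_update h', reached_update (agreeOn_mono htu h'),
      Function.update_of_ne hne]
  have hYloc : ∀ w w', w ≠ w' → IsLocal ms t u w' (Y w) := by
    intro w w' hne ws τ h h'
    simp only [Y, holds_update h']
  have hstep : ∀ w (Φ : (Fin W → PrefList M) → ℝ), (∀ ws, 0 ≤ Φ ws) → IsLocal ms t u w Φ →
      womenAvg p (fun ws => Φ ws * Y w ws) ≤ womenAvg p fun ws => Φ ws * X w ws := by
    intro w Φ hΦ hloc
    refine womenAvg_le_of_resample w fun ws => ?_
    by_cases hw : w ∈ reached (ms, ws) t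
    · refine Finset.sum_le_sum fun τ _ => mul_le_mul_of_nonneg_left
        (mul_le_mul_of_nonneg_left ?_ (hΦ _)) ENNReal.toReal_nonneg
      simp only [X, ind_of (Or.inl (mem_reached_update hw τ))]
      exact hY1 _ _
    -- Whether `w` is reached does not depend on her own list, but the man she holds does. Hence
    -- both sides are split according to that man.
    by_cases hwu : w ∈ reached (ms, ws) u
    · have hY' : ∀ τ, Φ (Function.update ws w τ) * Y w (Function.update ws w τ) =
          ∑ x, Real.exp (-β x) * (Φ (Function.update ws w τ) *
            ind (Holds (ms, Function.update ws w τ) u x w)) := by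
        intro τ
        have h1 := mem_reached_update hwu τ
        obtain ⟨x, hx⟩ := mem_reached_iff_holds.1 h1
        have h2 := sum_ind_holds_mul (fun x => Real.exp (-β x)) hx
        simp only [Y, sum_ind_holds_mul β hx]
        rw [← h2, Finset.mul_sum]
        exact Finset.sum_congr rfl fun _ _ => by ring
      have hX' : ∀ τ, Φ (Function.update ws w τ) * X w (Function.update ws w τ) =
          ∑ x, Φ (Function.update ws w τ) * ind (Holds (ms, Function.update ws w τ) u x w) *
            ind (∀ j : Fin M, u ≤ (j : ℕ) → τ.Prefers x j) := by
        intro τ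
        have h1 := mem_reached_update hwu τ
        obtain ⟨x, hx⟩ := mem_reached_iff_holds.1 h1
        have h2 := sum_ind_holds_mul
          (fun x => ind (∀ j : Fin M, u ≤ (j : ℕ) → τ.Prefers x j)) hx
        have h3 : X w (Function.update ws w τ) =
            ind (∀ j : Fin M, u ≤ (j : ℕ) → τ.Prefers x j) := by
          simp only [X, notMem_reached_update hw τ, false_or, Function.update_self]
          congr 1
          refine propext ⟨fun h => h x hx, fun h y hy => ?_⟩
          rwa [hy.man_unique hx]
        rw [h3, ← h2, Finset.mul_sum]
        exact Finset.sum_congr rfl fun _ _ => by ring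
      simp only [hY', hX', Finset.mul_sum]
      rw [Finset.sum_comm, Finset.sum_comm (s := Finset.univ (α := PrefList M))]
      refine Finset.sum_le_sum fun x _ => ?_
      by_cases hx : (x : ℕ) < u
      · refine le_trans (le_of_eq ?_) (sum_exp_mul_le hp hΦ hloc hw hx)
        rw [Finset.mul_sum]
        exact Finset.sum_congr rfl fun _ _ => by ring
      · have : ∀ τ, ¬ Holds (ms, Function.update ws w τ) u x w := fun τ h => hx h.1.lt
        simp [ind_of_not (this _)]
    · refine Finset.sum_le_sum fun τ _ => mul_le_mul_of_nonneg_left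
        (mul_le_mul_of_nonneg_left ?_ (hΦ _)) ENNReal.toReal_nonneg
      have h1 : X w (Function.update ws w τ) = 1 := ind_of (Or.inr fun x hx =>
        absurd (mem_reached.2 ⟨x, hx.1⟩) (notMem_reached_update hwu τ))
      rw [h1]
      exact hY1 _ _
  have hmain := productAvg_prod_le (p := fun w τ => (p w τ).toReal) (Loc := IsLocal ms t u)
    (fun w f g hf hg => hf.mul hg) (X := Y) (Y := X) (fun _ _ => (Real.exp_pos _).le)
    (fun _ _ => ind_nonneg) hYloc hXloc hstep Finset.univ Ψ hΨ0 (fun w _ => hΨ.isLocal u w)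
  -- In the product the exponents add up over distinct held men below `u`, so their sum is at most
  -- the double geometric sum.
  have hlow : ∀ ws, Real.exp (-(A / (1 - b) ^ 2)) ≤ ∏ w, Y w ws := by
    intro ws
    simp only [Y]
    rw [← Real.exp_sum, Finset.sum_neg_distrib, Finset.sum_comm]
    refine Real.exp_le_exp.2 (neg_le_neg ((Finset.sum_le_sum (g := fun x : Fin M =>
      if (x : ℕ) < u then β x else 0) fun x _ => ?_).trans ?_))
    · rw [← Finset.sum_mul]
      split_ifs with hx
      · exact mul_le_of_le_one_left (hβ x) (sum_ind_le_one fun _ _ h h' => h.woman_unique h')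
      · refine le_of_eq ?_
        rw [Finset.sum_eq_zero fun w _ => ind_of_not fun h => hx h.1.lt, zero_mul]
    · rw [← Finset.sum_filter]
      exact sum_oddsTail_le hp
  calc _ = womenAvg p (fun ws => Real.exp (-(A / (1 - b) ^ 2)) * Ψ ws) :=
        (productAvg_const_mul _ _ _).symm
    _ ≤ womenAvg p (fun ws => Ψ ws * ∏ w, Y w ws) := womenAvg_mono fun ws => by
        rw [mul_comm]
        exact mul_le_mul_of_nonneg_left (hlow ws) (hΨ0 ws)
    _ ≤ womenAvg p (fun ws => Ψ ws * ∏ w, X w ws) := hmain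
    _ ≤ _ := womenAvg_mono fun ws => by
        by_cases h0 : Ψ ws = 0
        · simp [h0]
        refine mul_le_mul_of_nonneg_left ?_ (hΨ0 ws)
        by_cases hall : ∀ w, w ∈ reached (ms, ws) t ∨
            ∀ x, Holds (ms, ws) u x w → ∀ j : Fin M, u ≤ (j : ℕ) → (ws w).Prefers x j
        · have hs : Secure (ms, ws) u u := by
            intro x w hxw j hj
            rcases hall w with hw | hw
            · obtain ⟨y, hy⟩ := mem_reached_iff_holds.1 hw
              have h1 : (ws w).Prefers y j := hsup ws h0 y w hy j hj
              rcases hy.mono_prefers htu hxw with rfl | h2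
              · exact h1
              · exact PrefList.Prefers.trans h2 h1
            · exact hw x hxw j hj
          rw [ind_of hs]
          exact Finset.prod_le_one (fun _ _ => ind_nonneg) fun _ _ => ind_le_one
        · push Not at hall
          obtain ⟨w, hw⟩ := hall
          rw [Finset.prod_eq_zero (Finset.mem_univ w)]
          · exact ind_nonneg
          · refine ind_of_not ?_
            push Not
            exact hw

end Profile

/-! ### Geometric tail of the gaps between secure levels -/

theorem summable_succ_pow_mul_geometric {r : ℝ} (h0 : 0 ≤ r) (h1 : r < 1) (n : ℕ) :
    Summable fun d : ℕ => ((d : ℝ) + 1) ^ n * r ^ d := by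
  rcases h0.eq_or_lt with rfl | h0
  · refine summable_of_ne_finset_zero (s := {0}) fun d hd => ?_
    rw [zero_pow (by simpa using hd), mul_zero]
  have h2 := summable_pow_mul_geometric_of_norm_lt_one n
    (show ‖r‖ < 1 by rwa [Real.norm_of_nonneg h0.le])
  have h3 := ((summable_nat_add_iff 1).2 h2).mul_right r⁻¹
  refine h3.congr fun d => ?_
  push_cast
  field_simp
  ring

/-- The rate at which the probability of having no secure level decreases. -/
theorem exists_rate {C b q : ℝ} (hC : 0 ≤ C) (hb0 : 0 < b) (hb1 : b < 1) (hq : 0 < q) :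
    ∃ y : ℝ, 1 < y ∧ ∀ D, ∑ d ∈ Finset.range D, C * b ^ d * (y ^ (d + 1) - 1) ≤ q := by
  set r := (1 + b) / 2 with hr
  have hr0 : 0 ≤ r := by rw [hr]; linarith
  have hr1 : r < 1 := by rw [hr]; linarith
  set G := ∑' d : ℕ, ((d : ℝ) + 1) ^ 1 * r ^ d with hG
  have hG0 : 0 ≤ G := tsum_nonneg fun d => by positivity
  -- The rate is `y = 1 + δ`. The first bound keeps `b * y ≤ r < 1`, so the series converges. The
  -- second makes it small, since `y ^ (d + 1) - 1` is at most `δ * (d + 1) * y ^ d`.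
  set δ := min (r / b - 1) (q / (C * G + 1)) with hδ
  have hrb : 1 < r / b := by rw [lt_div_iff₀ hb0, hr]; linarith
  have hδ0 : 0 < δ := lt_min (by linarith) (by positivity)
  have hCG : 0 < C * G + 1 := by positivity
  refine ⟨1 + δ, by linarith, fun D => ?_⟩
  have hby : b * (1 + δ) ≤ r := by
    have : 1 + δ ≤ r / b := by linarith [min_le_left (r / b - 1) (q / (C * G + 1))]
    calc _ ≤ b * (r / b) := by gcongr
      _ = r := by field_simp
  have hterm : ∀ d ∈ Finset.range D, C * b ^ d * ((1 + δ) ^ (d + 1) - 1) ≤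
      C * δ * (((d : ℝ) + 1) ^ 1 * r ^ d) := by
    intro d _
    have h1 : ∑ i ∈ Finset.range (d + 1), (1 + δ) ^ i ≤ ((d : ℝ) + 1) * (1 + δ) ^ d := by
      have := Finset.sum_le_card_nsmul (Finset.range (d + 1)) (fun i => (1 + δ) ^ i)
        ((1 + δ) ^ d) fun i hi => pow_le_pow_right₀ (by linarith)
          (Nat.lt_succ_iff.1 (Finset.mem_range.1 hi))
      simpa using this
    have h2 := geom_sum_mul (1 + δ) (d + 1)
    rw [← h2, add_sub_cancel_left]
    calc _ ≤ C * b ^ d * (((d : ℝ) + 1) * (1 + δ) ^ d * δ) := by gcongr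
      _ = C * δ * (((d : ℝ) + 1) ^ 1 * (b * (1 + δ)) ^ d) := by rw [mul_pow]; ring
      _ ≤ _ := by gcongr
  refine (Finset.sum_le_sum hterm).trans ?_
  rw [← Finset.mul_sum]
  have h3 : ∑ d ∈ Finset.range D, ((d : ℝ) + 1) ^ 1 * r ^ d ≤ G :=
    (summable_succ_pow_mul_geometric hr0 hr1 1).sum_le_tsum _ fun d _ => by positivity
  calc C * δ * ∑ d ∈ Finset.range D, ((d : ℝ) + 1) ^ 1 * r ^ d ≤ C * δ * G := by gcongr
    _ = δ * (C * G) := by ring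
    _ ≤ δ * (C * G + 1) := by gcongr; linarith
    _ ≤ q / (C * G + 1) * (C * G + 1) := by gcongr; exact min_le_right _ _
    _ = q := by field_simp

namespace Profile

variable {M W : ℕ} {ms : Fin M → PrefList W} {ws : Fin W → PrefList M}
  {t u : ℕ} {w : Fin W} {τ : PrefList M} {Φ Ψ : (Fin W → PrefList M) → ℝ}
  {p : Fin W → PMF (PrefList M)} {A b : ℝ}

/-- A renewal argument. If level `u` is not secure, let `u + d + 1` be the first level from which
the women reached by the first `u` men are protected. Then the pair `(u, u + d + 1)` takes the role
of `(t, u)`, and the induction runs on the number of levels left. The condition on `y` is what makes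
the generating function of the jump at most `1`. -/
theorem womenAvg_no_secure_le (hp : GeometricOdds p A b) {y : ℝ} (hy : 1 < y)
    (hyq : ∀ D, ∑ d ∈ Finset.range D, A / (1 - b) ^ 2 * b ^ d * (y ^ (d + 1) - 1) ≤
      Real.exp (-(A / (1 - b) ^ 2))) (k : ℕ) :
    ∀ {t u : ℕ} {Ψ : (Fin W → PrefList M) → ℝ}, t ≤ u → (∀ ws, 0 ≤ Ψ ws) → IsAdapted ms t Ψ →
      (∀ ws, Ψ ws ≠ 0 → Secure (ms, ws) t u) →
      womenAvg p (fun ws => Ψ ws * ind (∀ v, u ≤ v → v < u + k → ¬ Secure (ms, ws) v v)) ≤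
        (1 / y) ^ k * womenAvg p Ψ := by
  have hy0 : 0 < y := by linarith
  induction k using Nat.strong_induction_on with
  | _ k ih =>
  intro t u Ψ htu hΨ0 hΨ hsup
  rcases Nat.eq_zero_or_pos k with rfl | hk
  · rw [pow_zero, one_mul]
    exact womenAvg_mono fun ws => mul_le_of_le_one_right (hΨ0 ws) ind_le_one
  -- The weight of a jump of length exactly `d + 1`; it reads only lists of women reached by the
  -- first `u` men, so it is again adapted.
  let Ψ' : ℕ → (Fin W → PrefList M) → ℝ := fun d ws => Ψ ws *
    (ind (¬ Secure (ms, ws) u (u + d)) * ind (Secure (ms, ws) u (u + (d + 1))))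
  let e : ℕ → ℝ := fun d => womenAvg p fun ws => Ψ ws * ind (¬ Secure (ms, ws) u (u + d))
  have he0 : ∀ d, 0 ≤ e d := fun d => womenAvg_nonneg fun ws => mul_nonneg (hΨ0 ws) ind_nonneg
  have hΨ'0 : ∀ d ws, 0 ≤ Ψ' d ws := fun d ws =>
    mul_nonneg (hΨ0 ws) (mul_nonneg ind_nonneg ind_nonneg)
  have hΨ'e : ∀ d, womenAvg p (Ψ' d) = e d - e (d + 1) := by
    intro d
    simp only [e, womenAvg]
    rw [← productAvg_sub]
    congr 1
    ext ws
    simp only [Ψ', ← mul_sub]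
    congr 1
    by_cases h1 : Secure (ms, ws) u (u + d)
    · have h2 : Secure (ms, ws) u (u + (d + 1)) := h1.mono (by omega)
      rw [ind_of_not (not_not.2 h1), ind_of_not (not_not.2 h2)]
      ring
    · rw [ind_of h1, ind_not, one_mul]
      ring
  have hΨ'd : ∀ d, womenAvg p (fun ws => Ψ' d ws *
      ind (∀ v, u + (d + 1) ≤ v → v < u + (d + 1) + (k - (d + 1)) → ¬ Secure (ms, ws) v v)) ≤
      (1 / y) ^ k * (y ^ (d + 1) * (e d - e (d + 1))) := by
    intro d
    have h1 := ih (k - (d + 1)) (by omega) (t := u) (u := u + (d + 1)) (Ψ := Ψ' d) (by omega)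
      (hΨ'0 d) ((hΨ.mono htu).mul ((isAdapted_ind fun _ _ _ h =>
        not_congr (secure_update h _)).mul (isAdapted_secure ms u _)))
      (fun ws h => ind_ne_zero.1 (right_ne_zero_of_mul (right_ne_zero_of_mul h)))
    refine h1.trans ?_
    rw [← hΨ'e, ← mul_assoc]
    refine mul_le_mul_of_nonneg_right ?_ (womenAvg_nonneg (hΨ'0 d))
    rcases le_total (d + 1) k with hd | hd
    · refine le_of_eq ?_
      have : (1 / y) ^ k = (1 / y) ^ (k - (d + 1)) * (1 / y) ^ (d + 1) := by
        rw [← pow_add]; congr 1; omega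
      rw [this, mul_assoc, ← mul_pow, one_div_mul_cancel hy0.ne', one_pow, mul_one]
    -- The jump overshoots the `k` levels; nothing is left to bound, and `y ≥ 1` absorbs the excess.
    · have h2 : y ^ (d + 1) = y ^ k * y ^ (d + 1 - k) := by
        rw [← pow_add]; congr 1; omega
      have h3 : k - (d + 1) = 0 := by omega
      rw [h2, ← mul_assoc, ← mul_pow, one_div_mul_cancel hy0.ne', one_pow, one_mul, h3, pow_zero]
      exact one_le_pow₀ hy.le
  have hpt : ∀ ws, Ψ ws * ind (∀ v, u ≤ v → v < u + k → ¬ Secure (ms, ws) v v) ≤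
      ∑ d ∈ Finset.range M, Ψ' d ws *
        ind (∀ v, u + (d + 1) ≤ v → v < u + (d + 1) + (k - (d + 1)) → ¬ Secure (ms, ws) v v) := by
    intro ws
    have hnn : ∀ d ∈ Finset.range M, 0 ≤ Ψ' d ws *
        ind (∀ v, u + (d + 1) ≤ v → v < u + (d + 1) + (k - (d + 1)) → ¬ Secure (ms, ws) v v) :=
      fun d _ => mul_nonneg (hΨ'0 d ws) ind_nonneg
    by_cases hT : ∀ v, u ≤ v → v < u + k → ¬ Secure (ms, ws) v v
    swap
    · rw [ind_of_not hT, mul_zero]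
      exact Finset.sum_nonneg hnn
    classical
    have hex : ∃ d, Secure (ms, ws) u (u + d) := ⟨M, secure_of_le (by omega)⟩
    have h1 := Nat.find_spec hex
    have h2 := fun d (hd : d < Nat.find hex) => Nat.find_min hex hd
    have h3 : Nat.find hex ≤ M := Nat.find_min' hex (secure_of_le (by omega))
    generalize Nat.find hex = d at *
    have hd : d ≠ 0 := by
      rintro rfl
      exact hT u le_rfl (by omega) h1
    obtain ⟨d, rfl⟩ := Nat.exists_eq_succ_of_ne_zero hd
    refine le_trans (le_of_eq ?_) (Finset.single_le_sum hnn (Finset.mem_range.2 h3))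
    have h4 : ∀ v, u + (d + 1) ≤ v → v < u + (d + 1) + (k - (d + 1)) → ¬ Secure (ms, ws) v v :=
      fun v hv1 hv2 => hT v (by omega) (by omega)
    rw [ind_of hT, ind_of h4]
    simp only [Ψ']
    rw [ind_of (h2 d (by omega)), ind_of h1]
    ring
  have hq := le_womenAvg_secure hp htu hΨ0 hΨ hsup
  have he00 : e 0 = womenAvg p Ψ - womenAvg p (fun ws => Ψ ws * ind (Secure (ms, ws) u u)) := by
    simp only [e, womenAvg, add_zero]
    rw [← productAvg_sub]
    congr 1
    ext ws
    rw [ind_not]; ring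
  have hZ0 : 0 ≤ womenAvg p Ψ := womenAvg_nonneg hΨ0
  have hyd : ∀ d, 0 ≤ y ^ (d + 1) - 1 := fun d => sub_nonneg.2 (one_le_pow₀ hy.le)
  -- Write `y ^ (d + 1) = 1 + (y ^ (d + 1) - 1)`. The first part telescopes to at most `e 0`, which
  -- is at most `1 - q` times the total mass; the second is at most `q` times that mass, by `e d ≤ C
  -- * b ^ d` times the mass and the choice of `y`.
  have hsum : ∑ d ∈ Finset.range M, y ^ (d + 1) * (e d - e (d + 1)) ≤ womenAvg p Ψ := by
    calc _ ≤ ∑ d ∈ Finset.range M, ((e d - e (d + 1)) +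
          A / (1 - b) ^ 2 * b ^ d * (y ^ (d + 1) - 1) * womenAvg p Ψ) := by
          refine Finset.sum_le_sum fun d _ => ?_
          have h1 : e d ≤ A / (1 - b) ^ 2 * b ^ d * womenAvg p Ψ :=
            womenAvg_not_secure_le hp htu hΨ0 hΨ hsup d
          have h2 := mul_le_mul_of_nonneg_left h1 (hyd d)
          have h3 := mul_nonneg (hyd d) (he0 (d + 1))
          nlinarith
      _ = (e 0 - e M) + (∑ d ∈ Finset.range M, A / (1 - b) ^ 2 * b ^ d * (y ^ (d + 1) - 1)) *
          womenAvg p Ψ := by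
          rw [Finset.sum_add_distrib, Finset.sum_range_sub', Finset.sum_mul]
      _ ≤ (e 0 - e M) + Real.exp (-(A / (1 - b) ^ 2)) * womenAvg p Ψ := by
          gcongr
          exact hyq M
      _ ≤ _ := by
          have := he0 M
          linarith
  calc _ ≤ womenAvg p (fun ws => ∑ d ∈ Finset.range M, Ψ' d ws *
        ind (∀ v, u + (d + 1) ≤ v → v < u + (d + 1) + (k - (d + 1)) →
          ¬ Secure (ms, ws) v v)) := womenAvg_mono hpt
    _ = ∑ d ∈ Finset.range M, womenAvg p (fun ws => Ψ' d ws *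
        ind (∀ v, u + (d + 1) ≤ v → v < u + (d + 1) + (k - (d + 1)) →
          ¬ Secure (ms, ws) v v)) := by
        simp only [womenAvg, productAvg_sum]
    _ ≤ ∑ d ∈ Finset.range M, (1 / y) ^ k * (y ^ (d + 1) * (e d - e (d + 1))) :=
        Finset.sum_le_sum fun d _ => hΨ'd d
    _ ≤ _ := by
        rw [← Finset.mul_sum]
        exact mul_le_mul_of_nonneg_left hsum (by positivity)

/-- The women of `G`, who have not been reached, are unlikely to all prefer someone from level
`t` on to `x`. -/
theorem womenAvg_unsaved_le (hp : GeometricOdds p A b) (hΨ0 : ∀ ws, 0 ≤ Ψ ws)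
    (hΨ : IsAdapted ms t Ψ) {x : Fin M} (hx : (x : ℕ) < t)
    (G : (Fin W → PrefList M) → Finset (Fin W))
    (hG : ∀ w ws τ, w ∉ reached (ms, ws) t → G (Function.update ws w τ) = G ws)
    (hGt : ∀ ws, ∀ w ∈ G ws, w ∉ reached (ms, ws) t) {L : ℕ}
    (hL : ∀ ws, Ψ ws ≠ 0 → L ≤ (G ws).card) :
    womenAvg p (fun ws => Ψ ws *
        ind (∀ g ∈ G ws, ¬ ∀ j : Fin M, t ≤ (j : ℕ) → (ws g).Prefers x j)) ≤
      (1 - Real.exp (-(A / (1 - b) ^ 2))) ^ L * womenAvg p Ψ := by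
  classical
  set q := Real.exp (-(A / (1 - b) ^ 2)) with hq
  have hq0 : 0 < q := Real.exp_pos _
  have hq1 : q ≤ 1 := Real.exp_le_one_iff.2 (neg_nonpos.2
    (div_nonneg hp.A_nonneg (sq_nonneg _)))
  have h1q : 0 ≤ 1 - q := by linarith
  let X : Fin W → (Fin W → PrefList M) → ℝ := fun w ws =>
    ind (w ∈ G ws → ¬ ∀ j : Fin M, t ≤ (j : ℕ) → (ws w).Prefers x j)
  let Y : Fin W → (Fin W → PrefList M) → ℝ := fun w ws => if w ∈ G ws then 1 - q else 1
  have hXloc : ∀ w w', w ≠ w' → IsLocal ms t t w' (X w) := by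
    intro w w' hne ws τ h h'
    simp only [X, hG w' ws τ h, Function.update_of_ne hne]
  have hYloc : ∀ w w', w ≠ w' → IsLocal ms t t w' (Y w) := by
    intro w w' hne ws τ h h'
    simp only [Y, hG w' ws τ h]
  have hY0 : ∀ w ws, 0 ≤ Y w ws := fun w ws => by simp only [Y]; split_ifs <;> linarith
  have hstep : ∀ w (Φ : (Fin W → PrefList M) → ℝ), (∀ ws, 0 ≤ Φ ws) → IsLocal ms t t w Φ →
      womenAvg p (fun ws => Φ ws * X w ws) ≤ womenAvg p fun ws => Φ ws * Y w ws := by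
    intro w Φ hΦ hloc
    refine womenAvg_le_of_resample w fun ws => ?_
    by_cases hw : w ∈ reached (ms, ws) t
    · refine Finset.sum_le_sum fun τ _ => mul_le_mul_of_nonneg_left
        (mul_le_mul_of_nonneg_left ?_ (hΦ _)) ENNReal.toReal_nonneg
      simp only [Y, if_neg fun h => hGt _ w h (mem_reached_update hw τ)]
      exact ind_le_one
    have hΦc : ∀ τ, Φ (Function.update ws w τ) = Φ ws := fun τ =>
      hloc ws τ hw (agreeOn_of_notMem_reached hw)
    by_cases hwG : w ∈ G ws
    · have hX' : ∀ τ, X w (Function.update ws w τ) =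
          1 - ind (∀ j : Fin M, t ≤ (j : ℕ) → τ.Prefers x j) := by
        intro τ
        simp only [X, hG w ws τ hw, hwG, forall_const, Function.update_self, ind_not]
      have hY' : ∀ τ, Y w (Function.update ws w τ) = 1 - q := by
        intro τ
        simp only [Y, hG w ws τ hw, hwG, if_true]
      -- The list of `w` is entirely fresh, so the revealed chain is `x` alone.
      have h1 := (hp.regular w).prod_mul_sum_le (a := x)
        (Finset.univ.filter (fun j : Fin M => t ≤ (j : ℕ))) (S := fun _ => {x})
        (Φ := fun _ => 1) (fun _ => zero_le_one) (fun _ _ _ => ⟨rfl, rfl⟩)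
        (fun _ _ => ⟨rfl, fun b hb hne => absurd hb hne⟩) (by simpa using hx)
      have h2 := hp.exp_neg_oddsTail_le w hx
      have h3 : q ≤ Real.exp (-oddsTail A b M t x) :=
        Real.exp_le_exp.2 (neg_le_neg (oddsTail_le hp hx))
      simp only [hΦc, hX', hY']
      have h4 : ∑ τ, ((p w) τ).toReal * ind (∀ j : Fin M, t ≤ (j : ℕ) → τ.Prefers x j) =
          ∑ τ, ((p w) τ).toReal * (1 * if ∀ j ∈ Finset.univ.filter
            (fun j : Fin M => t ≤ (j : ℕ)), τ.Prefers x j then 1 else 0) := by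
        refine Finset.sum_congr rfl fun τ _ => ?_
        have e : (∀ j ∈ Finset.univ.filter (fun j : Fin M => t ≤ (j : ℕ)), τ.Prefers x j) ↔
            ∀ j : Fin M, t ≤ (j : ℕ) → τ.Prefers x j := by simp
        by_cases h : ∀ j : Fin M, t ≤ (j : ℕ) → τ.Prefers x j
        · rw [ind_of h, if_pos (e.2 h), one_mul]
        · rw [ind_of_not h, if_neg fun h' => h (e.1 h'), one_mul]
      have h5 := sum_toReal_pmf (p w)
      simp only [mul_one, h5] at h1
      have h6 : ∑ τ, (p w τ).toReal *
          (Φ ws * (1 - ind (∀ j : Fin M, t ≤ (j : ℕ) → τ.Prefers x j))) = Φ ws *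
          (1 - ∑ τ, (p w τ).toReal * ind (∀ j : Fin M, t ≤ (j : ℕ) → τ.Prefers x j)) := by
        simp only [mul_sub, mul_one]
        rw [Finset.sum_sub_distrib, ← Finset.sum_mul, h5, one_mul, Finset.mul_sum]
        exact congrArg _ (Finset.sum_congr rfl fun _ _ => by ring)
      rw [h6, ← Finset.sum_mul, h5, one_mul]
      refine mul_le_mul_of_nonneg_left ?_ (hΦ ws)
      rw [h4]
      linarith
    · refine Finset.sum_le_sum fun τ _ => mul_le_mul_of_nonneg_left
        (mul_le_mul_of_nonneg_left ?_ (hΦ _)) ENNReal.toReal_nonneg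
      simp only [Y, hG w ws τ hw, if_neg hwG]
      exact ind_le_one
  have hmain := productAvg_prod_le (p := fun w τ => (p w τ).toReal) (Loc := IsLocal ms t t)
    (fun w f g hf hg => hf.mul hg) (X := X) (Y := Y) (fun _ _ => ind_nonneg) hY0
    hXloc hYloc hstep Finset.univ Ψ hΨ0 (fun w _ => hΨ.isLocal t w)
  calc _ ≤ womenAvg p (fun ws => Ψ ws * ∏ w, X w ws) := womenAvg_mono fun ws => by
        refine mul_le_mul_of_nonneg_left ?_ (hΨ0 ws)
        by_cases h : ∀ g ∈ G ws, ¬ ∀ j : Fin M, t ≤ (j : ℕ) → (ws g).Prefers x j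
        · rw [Finset.prod_eq_one fun w _ => ind_of (h w)]
          exact ind_le_one
        · rw [ind_of_not h]
          exact Finset.prod_nonneg fun _ _ => ind_nonneg
    _ ≤ womenAvg p (fun ws => Ψ ws * ∏ w, Y w ws) := hmain
    _ ≤ womenAvg p (fun ws => (1 - q) ^ L * Ψ ws) := womenAvg_mono fun ws => by
        by_cases h0 : Ψ ws = 0
        · simp [h0]
        rw [mul_comm]
        refine mul_le_mul_of_nonneg_right ?_ (hΨ0 ws)
        simp only [Y]
        rw [Finset.prod_ite, Finset.prod_const_one, mul_one, Finset.prod_const,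
          Finset.filter_univ_mem]
        exact pow_le_pow_of_le_one h1q (by linarith) (hL ws h0)
    _ = _ := productAvg_const_mul _ _ _

end Profile

/-! ### Favourites in a uniformly random list -/

namespace PrefList

variable {n : ℕ} {U : Finset (Fin n)} {a b : Fin n}

theorem prefers_mul (τ e : PrefList n) : PrefList.Prefers (τ * e) a b ↔ τ.Prefers (e a) (e b) :=
  Iff.rfl

theorem rankIn_mul (τ : PrefList n) (e : Equiv.Perm (Fin n)) (he : ∀ c, e c ∈ U ↔ c ∈ U) :
    PrefList.rankIn (τ * e) U a = τ.rankIn U (e a) := by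
  classical
  refine Finset.card_bij (fun c _ => e c) (fun c hc => ?_) (fun _ _ _ _ h => e.injective h)
    fun c hc => ⟨e.symm c, ?_, e.apply_symm_apply c⟩
  · simp only [Finset.mem_filter, he] at hc ⊢
    exact ⟨hc.1, hc.2⟩
  · simp only [Finset.mem_filter] at hc ⊢
    refine ⟨(he _).1 (by simpa using hc.1), ?_⟩
    rw [prefers_mul, e.apply_symm_apply]
    exact hc.2

/-- Swapping `a` and `b` permutes the lists and preserves `U`. -/
theorem sum_ind_mem_topIn_eq (r : ℕ) (ha : a ∈ U) (hb : b ∈ U) :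
    ∑ τ : PrefList n, ind (a ∈ τ.topIn U r) = ∑ τ : PrefList n, ind (b ∈ τ.topIn U r) := by
  rw [← Equiv.sum_comp (Equiv.mulRight (Equiv.swap a b))]
  refine Finset.sum_congr rfl fun τ _ => ?_
  have he : ∀ c, Equiv.swap a b c ∈ U ↔ c ∈ U := by
    intro c
    by_cases h1 : c = a
    · subst h1; simp [ha, hb]
    by_cases h2 : c = b
    · subst h2; simp [ha, hb]
    rw [Equiv.swap_apply_of_ne_of_ne h1 h2]
  simp only [Equiv.coe_mulRight, mem_topIn, ha, hb, true_and, rankIn_mul τ _ he,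
    Equiv.swap_apply_left]

/-- In a uniformly random list, the probability of being among the `r` favourites of `U`. -/
theorem sum_ind_mem_topIn_le (r : ℕ) (ha : a ∈ U) :
    ∑ τ : PrefList n, ((Fintype.card (PrefList n) : ℝ))⁻¹ * ind (a ∈ τ.topIn U r) ≤
      r / U.card := by
  have hU : (0 : ℝ) < U.card := by exact_mod_cast Finset.card_pos.2 ⟨a, ha⟩
  have hc : (0 : ℝ) < Fintype.card (PrefList n) := by exact_mod_cast Fintype.card_pos
  have h1 : (U.card : ℝ) * ∑ τ : PrefList n, ind (a ∈ τ.topIn U r) ≤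
      Fintype.card (PrefList n) * r := by
    calc _ = ∑ b ∈ U, ∑ τ : PrefList n, ind (b ∈ τ.topIn U r) := by
          rw [Finset.sum_congr rfl fun b hb => sum_ind_mem_topIn_eq r hb ha]
          simp
      _ = ∑ τ : PrefList n, ∑ b ∈ U, ind (b ∈ τ.topIn U r) := Finset.sum_comm
      _ ≤ ∑ _τ : PrefList n, (r : ℝ) := by
          refine Finset.sum_le_sum fun τ _ => ?_
          have : ∑ b ∈ U, ind (b ∈ τ.topIn U r) = (τ.topIn U r).card := by
            rw [← Finset.sum_subset (s₁ := τ.topIn U r) (fun _ h => (mem_topIn.1 h).1)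
              (fun _ _ h => ind_of_not h), Finset.sum_congr rfl fun _ h => ind_of h]
            simp
          rw [this]
          exact_mod_cast τ.card_topIn_le U r
      _ = _ := by simp
  rw [← Finset.mul_sum, inv_mul_le_iff₀ hc, mul_div_assoc', le_div_iff₀ hU]
  linarith

end PrefList

/-! ### Collisions between men with uniform lists -/

namespace Profile

variable {M W : ℕ} {p : Fin W → PMF (PrefList M)}

/-- The average over the uniformly random lists of the men. -/
noncomputable def menAvg (M W : ℕ) (F : (Fin M → PrefList W) → ℝ) : ℝ :=
  productAvg (fun (_ : Fin M) (_ : PrefList W) => ((Fintype.card (PrefList W) : ℝ))⁻¹) F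

theorem expectation_eq (p : Fin W → PMF (PrefList M)) (f : Profile M W → ℝ) :
    expectation p f = menAvg M W fun ms => womenAvg p fun ws => f (ms, ws) := by
  rw [expectation, Fintype.sum_prod_type, menAvg, productAvg]
  refine Finset.sum_congr rfl fun ms _ => ?_
  rw [womenAvg, productAvg, Finset.mul_sum]
  refine Finset.sum_congr rfl fun ws _ => ?_
  rw [profileLaw, PMF.ofFintype_apply, ENNReal.toReal_mul, ENNReal.toReal_prod,
    ENNReal.toReal_prod, mul_assoc]
  simp [PMF.uniformOfFintype_apply]

theorem menAvg_weight_nonneg (W : ℕ) : 0 ≤ ((Fintype.card (PrefList W) : ℝ))⁻¹ := by positivity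

theorem menAvg_weight_sum (W : ℕ) :
    ∑ _τ : PrefList W, ((Fintype.card (PrefList W) : ℝ))⁻¹ = 1 := by
  have : (Fintype.card (PrefList W) : ℝ) ≠ 0 := by exact_mod_cast Fintype.card_ne_zero
  rw [Finset.sum_const, nsmul_eq_mul, Finset.card_univ, mul_inv_cancel₀ this]

theorem menAvg_mono {F G : (Fin M → PrefList W) → ℝ} (h : ∀ ms, F ms ≤ G ms) :
    menAvg M W F ≤ menAvg M W G := productAvg_mono (fun _ _ => menAvg_weight_nonneg W) h

theorem menAvg_const (c : ℝ) : menAvg M W (fun _ => c) = c :=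
  productAvg_const (fun _ => menAvg_weight_sum W) c

theorem womenAvg_const (c : ℝ) : womenAvg p (fun _ => c) = c :=
  productAvg_const (fun w => sum_toReal_pmf (p w)) c

theorem expectation_mono {f g : Profile M W → ℝ} (h : ∀ P, f P ≤ g P) :
    expectation p f ≤ expectation p g :=
  Finset.sum_le_sum fun P _ => mul_le_mul_of_nonneg_left (h P) ENNReal.toReal_nonneg

theorem expectation_const_mul (c : ℝ) (f : Profile M W → ℝ) :
    expectation p (fun P => c * f P) = c * expectation p f := by
  simp only [expectation, Finset.mul_sum]
  exact Finset.sum_congr rfl fun _ _ => by ring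

theorem expectation_sum {κ : Type*} (s : Finset κ) (f : κ → Profile M W → ℝ) :
    expectation p (fun P => ∑ k ∈ s, f k P) = ∑ k ∈ s, expectation p (f k) := by
  simp only [expectation, Finset.mul_sum]
  exact Finset.sum_comm

theorem reached_update_man {ms : Fin M → PrefList W} {ws : Fin W → PrefList M} {s : ℕ}
    {x : Fin M} (hx : s ≤ x) (τ : PrefList W) :
    reached (Function.update ms x τ, ws) s = reached (ms, ws) s := by
  ext w
  simp only [mem_reached]
  refine exists_congr fun m => (proposes_congr (P := (ms, ws))
    (Q := (Function.update ms x τ, ws)) (fun m hm => ?_) fun _ => PrefList.AgreeOn.refl _ _).symm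
  have : m ≠ x := by rintro rfl; omega
  simp [Function.update_of_ne this]

theorem le_card_compl_reached (P : Profile M W) (s : ℕ) : W - s ≤ ((P.reached s)ᶜ).card := by
  rw [Finset.card_compl, Fintype.card_fin]
  have := P.card_reached_le s
  omega

/-- Only the list of `x` is resampled. As `s ≤ x`, this changes neither the women reached by the
first `s` men nor the favourite of `y`, which is a single woman among at least `W - s` candidates.
-/
theorem expectation_compete_le {s r : ℕ} (hs : s < W) {x y : Fin M} (hxy : x ≠ y)
    (hx : s ≤ x) : expectation p (fun P => ind (∃ w ∈ (P.1 y).topIn (P.reached s)ᶜ 1,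
      w ∈ (P.1 x).topIn (P.reached s)ᶜ r)) ≤ r / ((W : ℝ) - s) := by
  rw [expectation_eq, menAvg, productAvg_resample (fun _ => menAvg_weight_sum W) x]
  have hWs : (0 : ℝ) < (W : ℝ) - s := sub_pos.2 (by exact_mod_cast hs)
  refine (menAvg_mono fun ms => ?_).trans (menAvg_const _).le
  have e : ∀ τ : PrefList W, ((Fintype.card (PrefList W) : ℝ))⁻¹ * womenAvg p (fun ws =>
      ind (∃ w ∈ ((Function.update ms x τ) y).topIn
        (reached (Function.update ms x τ, ws) s)ᶜ 1,
        w ∈ ((Function.update ms x τ) x).topIn (reached (Function.update ms x τ, ws) s)ᶜ r)) =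
      womenAvg p (fun ws => ((Fintype.card (PrefList W) : ℝ))⁻¹ *
        ind (∃ w ∈ (ms y).topIn (reached (ms, ws) s)ᶜ 1,
          w ∈ τ.topIn (reached (ms, ws) s)ᶜ r)) := by
    intro τ
    rw [womenAvg, womenAvg, productAvg_const_mul]
    simp only [reached_update_man hx, Function.update_of_ne hxy.symm, Function.update_self]
  simp only [e]
  simp only [womenAvg]
  rw [← productAvg_sum]
  refine (womenAvg_mono fun ws => ?_).trans (womenAvg_const (p := p) _).le
  set U := (reached (ms, ws) s)ᶜ with hU
  have hUc : (W : ℝ) - s ≤ U.card := by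
    have h1 : W ≤ U.card + s := by
      have : W - s ≤ U.card := le_card_compl_reached (ms, ws) s
      omega
    have : (W : ℝ) ≤ U.card + s := by exact_mod_cast h1
    linarith
  calc _ ≤ ∑ τ : PrefList W, ∑ w ∈ (ms y).topIn U 1,
        ((Fintype.card (PrefList W) : ℝ))⁻¹ * ind (w ∈ τ.topIn U r) := by
        refine Finset.sum_le_sum fun τ _ => ?_
        rw [← Finset.mul_sum]
        refine mul_le_mul_of_nonneg_left ?_ (menAvg_weight_nonneg W)
        by_cases h : ∃ w ∈ (ms y).topIn U 1, w ∈ τ.topIn U r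
        · obtain ⟨w, hw, hw'⟩ := h
          refine ind_le_one.trans ?_
          rw [← ind_of hw']
          exact Finset.single_le_sum (f := fun w => ind (w ∈ τ.topIn U r))
            (fun _ _ => ind_nonneg) hw
        · rw [ind_of_not h]
          exact Finset.sum_nonneg fun _ _ => ind_nonneg
    _ = ∑ w ∈ (ms y).topIn U 1, ∑ τ : PrefList W,
        ((Fintype.card (PrefList W) : ℝ))⁻¹ * ind (w ∈ τ.topIn U r) := Finset.sum_comm
    _ ≤ ∑ w ∈ (ms y).topIn U 1, (r : ℝ) / U.card :=
        Finset.sum_le_sum fun w hw => PrefList.sum_ind_mem_topIn_le r (PrefList.mem_topIn.1 hw).1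
    _ ≤ (r : ℝ) / U.card := by
        rw [Finset.sum_const, nsmul_eq_mul]
        refine mul_le_of_le_one_left (by positivity) ?_
        exact_mod_cast PrefList.card_topIn_le _ _ _
    _ ≤ _ := by gcongr

theorem expectation_collides_le {s k r : ℕ} (hs : s < W) :
    expectation p (fun P => ind (P.Collides s k r)) ≤
      (k : ℝ) ^ 2 * (r / ((W : ℝ) - s)) := by
  have hWs : (0 : ℝ) < (W : ℝ) - s := sub_pos.2 (by exact_mod_cast hs)
  set B := Finset.univ.filter fun x : Fin M => s ≤ (x : ℕ) ∧ (x : ℕ) < s + k with hB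
  have hBk : (B.card : ℝ) ≤ k := by exact_mod_cast card_block_le M s k
  have hpt : ∀ P : Profile M W, ind (P.Collides s k r) ≤ ∑ x ∈ B, ∑ y ∈ B,
      ind (x ≠ y ∧ ∃ w ∈ (P.1 y).topIn (P.reached s)ᶜ 1,
        w ∈ (P.1 x).topIn (P.reached s)ᶜ r) := by
    intro P
    by_cases h : P.Collides s k r
    · obtain ⟨x, y, hne, hx, hy, hw⟩ := h
      refine ind_le_one.trans ?_
      rw [← ind_of (⟨hne, hw⟩ : x ≠ y ∧ ∃ w ∈ (P.1 y).topIn (P.reached s)ᶜ 1,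
        w ∈ (P.1 x).topIn (P.reached s)ᶜ r)]
      exact (Finset.single_le_sum (f := fun y => ind (x ≠ y ∧
        ∃ w ∈ (P.1 y).topIn (P.reached s)ᶜ 1, w ∈ (P.1 x).topIn (P.reached s)ᶜ r))
        (fun _ _ => ind_nonneg) (by simp [hB, hy])).trans
        (Finset.single_le_sum (f := fun x => ∑ y ∈ B, ind (x ≠ y ∧
        ∃ w ∈ (P.1 y).topIn (P.reached s)ᶜ 1, w ∈ (P.1 x).topIn (P.reached s)ᶜ r))
        (fun _ _ => Finset.sum_nonneg fun _ _ => ind_nonneg) (by simp [hB, hx]))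
    · rw [ind_of_not h]
      exact Finset.sum_nonneg fun _ _ => Finset.sum_nonneg fun _ _ => ind_nonneg
  refine (expectation_mono hpt).trans ?_
  simp only [expectation_sum]
  have hle : ∀ x ∈ B, ∀ y ∈ B, expectation p (fun P => ind (x ≠ y ∧
      ∃ w ∈ (P.1 y).topIn (P.reached s)ᶜ 1, w ∈ (P.1 x).topIn (P.reached s)ᶜ r)) ≤
      r / ((W : ℝ) - s) := by
    intro x hx y _
    by_cases hxy : x = y
    · have : ∀ P : Profile M W, ind (x ≠ y ∧ ∃ w ∈ (P.1 y).topIn (P.reached s)ᶜ 1,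
          w ∈ (P.1 x).topIn (P.reached s)ᶜ r) = 0 := fun P => ind_of_not fun h => h.1 hxy
      simp only [this, expectation, mul_zero, Finset.sum_const_zero]
      positivity
    · exact (expectation_mono fun P => ind_mono fun h => h.2).trans
        (expectation_compete_le hs hxy (Finset.mem_filter.1 hx).2.1)
  calc _ ≤ ∑ x ∈ B, ∑ y ∈ B, (r : ℝ) / ((W : ℝ) - s) :=
        Finset.sum_le_sum fun x hx => Finset.sum_le_sum fun y hy => hle x hx y hy
    _ = (B.card : ℝ) ^ 2 * (r / ((W : ℝ) - s)) := by
        simp only [Finset.sum_const, nsmul_eq_mul]; ring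
    _ ≤ _ := by gcongr

/-! ### Probability of a bad block and the final summation -/

variable {A b : ℝ} {ms : Fin M → PrefList W}

/-- The security of level `s` starts the renewal at `(s, s + 1)`; the exponent counts the `k - 1`
levels strictly inside the block. -/
theorem womenAvg_gap_le (hp : GeometricOdds p A b) {y : ℝ} (hy : 1 < y)
    (hyq : ∀ D, ∑ d ∈ Finset.range D, A / (1 - b) ^ 2 * b ^ d * (y ^ (d + 1) - 1) ≤
      Real.exp (-(A / (1 - b) ^ 2))) {s k : ℕ} (hk : 1 ≤ k)
    {Ψ : (Fin W → PrefList M) → ℝ} (hΨ0 : ∀ ws, 0 ≤ Ψ ws) (hΨ : IsAdapted ms s Ψ) :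
    womenAvg p (fun ws => Ψ ws * ind (Secure (ms, ws) s s ∧
        ∀ v, s < v → v < s + k → ¬ Secure (ms, ws) v v)) ≤
      (1 / y) ^ (k - 1) * womenAvg p Ψ := by
  have h1 := womenAvg_no_secure_le hp hy hyq (k - 1) (t := s) (u := s + 1)
    (Ψ := fun ws => Ψ ws * ind (Secure (ms, ws) s s)) (Nat.le_succ s)
    (fun ws => mul_nonneg (hΨ0 ws) ind_nonneg) (hΨ.mul (isAdapted_secure ms s s))
    (fun ws h => (ind_ne_zero.1 (right_ne_zero_of_mul h)).mono (Nat.le_succ s))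
  have h2 : womenAvg p (fun ws => Ψ ws * ind (Secure (ms, ws) s s)) ≤ womenAvg p Ψ :=
    womenAvg_mono fun ws => mul_le_of_le_one_right (hΨ0 ws) ind_le_one
  refine le_trans (le_of_eq ?_) (h1.trans (mul_le_mul_of_nonneg_left h2 (by positivity)))
  congr 1
  ext ws
  rw [ind_and, mul_assoc]
  have : s + 1 + (k - 1) = s + k := by omega
  rw [this]
  rfl

/-- The collision is determined before the gap, so it factors in front of the gap's tail. The gap
and the security of its end are determined by the first `s + k` men, so the saving women, unreached
by them, are fresh and contribute `(1 - q) ^ L`. -/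
theorem womenAvg_isBadBlock_le (hp : GeometricOdds p A b) {y : ℝ} (hy : 1 < y)
    (hyq : ∀ D, ∑ d ∈ Finset.range D, A / (1 - b) ^ 2 * b ^ d * (y ^ (d + 1) - 1) ≤
      Real.exp (-(A / (1 - b) ^ 2))) {s k L : ℕ} (hk : 1 ≤ k) (hsM : s ≤ M)
    (hsr : s + (k + L) ≤ W) :
    womenAvg p (fun ws => ind (IsBadBlock (ms, ws) s k (k + L))) ≤
      (1 / y) ^ (k - 1) * (womenAvg p (fun ws => ind (Collides (ms, ws) s k (k + L))) +
        k * (1 - Real.exp (-(A / (1 - b) ^ 2))) ^ L) := by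
  set q := Real.exp (-(A / (1 - b) ^ 2)) with hq
  have hq1 : 0 ≤ 1 - q := sub_nonneg.2 (Real.exp_le_one_iff.2 (neg_nonpos.2
    (div_nonneg hp.A_nonneg (sq_nonneg _))))
  set B := Finset.univ.filter fun x : Fin M => s ≤ (x : ℕ) ∧ (x : ℕ) < s + k with hB
  have hBk : (B.card : ℝ) ≤ k := by exact_mod_cast card_block_le M s k
  let E : (Fin W → PrefList M) → Prop := fun ws => Secure (ms, ws) s s ∧
    ∀ v, s < v → v < s + k → ¬ Secure (ms, ws) v v
  let E' : (Fin W → PrefList M) → Prop := fun ws => E ws ∧ Secure (ms, ws) (s + k) (s + k)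
  have hE'ad : IsAdapted ms (s + k) fun ws => ind (E' ws) := by
    refine isAdapted_ind fun w ws τ hw => ?_
    have h1 : ∀ v, v ≤ s + k → (Secure (ms, Function.update ws w τ) v v ↔
        Secure (ms, ws) v v) := fun v hv => secure_update (fun hc => hw (reached_mono hv hc)) v
    simp only [E', E, h1 s (by omega), h1 (s + k) le_rfl]
    refine and_congr_left fun _ => and_congr_right fun _ => ?_
    refine forall_congr' fun v => forall_congr' fun _ => forall_congr' fun hv => ?_
    rw [h1 v hv.le]
  have hcolad : IsAdapted ms s fun ws => ind (Collides (ms, ws) s k (k + L)) := by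
    refine isAdapted_ind fun w ws τ hw => ?_
    simp only [Collides, reached_update (agreeOn_of_notMem_reached hw)]
  have hE' : womenAvg p (fun ws => ind (E' ws)) ≤ (1 / y) ^ (k - 1) := by
    have h1 := womenAvg_gap_le hp hy hyq (s := s) hk (ms := ms) (Ψ := fun _ => 1)
      (fun _ => zero_le_one) (fun _ _ _ _ => rfl)
    rw [womenAvg_const, mul_one] at h1
    refine (womenAvg_mono fun ws => ?_).trans h1
    rw [one_mul]
    exact ind_mono fun h => h.1
  let G : Fin M → (Fin W → PrefList M) → Finset (Fin W) := fun x ws =>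
    (ms x).topIn (reached (ms, ws) s)ᶜ (k + L) \ reached (ms, ws) (s + k)
  have huns : ∀ x ∈ B, womenAvg p (fun ws => ind (E' ws) *
      ind (∀ g ∈ G x ws, ¬ ∀ j : Fin M, s + k ≤ (j : ℕ) → (ws g).Prefers x j)) ≤
      (1 - q) ^ L * (1 / y) ^ (k - 1) := by
    intro x hx
    refine (womenAvg_unsaved_le hp (fun _ => ind_nonneg) hE'ad (Finset.mem_filter.1 hx).2.2
      (G x) (fun w ws τ hw => ?_) (fun ws w hw => (Finset.mem_sdiff.1 hw).2) (L := L)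
      (fun ws _ => ?_)).trans (mul_le_mul_of_nonneg_left hE' (by positivity))
    · have h1 : w ∉ reached (ms, ws) s := fun hc => hw (reached_mono (by omega) hc)
      simp only [G, reached_update (agreeOn_of_notMem_reached hw),
        reached_update (agreeOn_of_notMem_reached h1)]
    -- At most `k` women are newly reached between `s` and `s + k`, so at least `L` of the `k + L`
    -- favourites remain unreached.
    · have h1 : k + L ≤ ((ms x).topIn (reached (ms, ws) s)ᶜ (k + L)).card :=
        PrefList.le_card_topIn (le_trans (by omega) (le_card_compl_reached (ms, ws) s))
      have h2 : (reached (ms, ws) s).card = s := card_reached_eq_of_lt hsM (by omega)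
      have h3 := card_reached_le (ms, ws) (s + k)
      have h4 := Finset.card_sdiff_add_card_eq_card
        (reached_mono (P := (ms, ws)) (show s ≤ s + k by omega))
      have h5 : (ms x).topIn (reached (ms, ws) s)ᶜ (k + L) ∩ reached (ms, ws) (s + k) ⊆
          reached (ms, ws) (s + k) \ reached (ms, ws) s := by
        intro w hw
        obtain ⟨h6, h7⟩ := Finset.mem_inter.1 hw
        exact Finset.mem_sdiff.2 ⟨h7, Finset.mem_compl.1 (PrefList.mem_topIn.1 h6).1⟩
      have h6 := Finset.card_le_card h5
      have h7 := Finset.card_sdiff_add_card_inter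
        ((ms x).topIn (reached (ms, ws) s)ᶜ (k + L)) (reached (ms, ws) (s + k))
      simp only [G]
      omega
  have hpt : ∀ ws, ind (IsBadBlock (ms, ws) s k (k + L)) ≤
      ind (Collides (ms, ws) s k (k + L)) * ind (E ws) + ∑ x ∈ B, ind (E' ws) *
        ind (∀ g ∈ G x ws, ¬ ∀ j : Fin M, s + k ≤ (j : ℕ) → (ws g).Prefers x j) := by
    intro ws
    have hnn : ∀ x ∈ B, 0 ≤ ind (E' ws) *
        ind (∀ g ∈ G x ws, ¬ ∀ j : Fin M, s + k ≤ (j : ℕ) → (ws g).Prefers x j) :=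
      fun _ _ => mul_nonneg ind_nonneg ind_nonneg
    by_cases h : IsBadBlock (ms, ws) s k (k + L)
    swap
    · rw [ind_of_not h]
      exact add_nonneg (mul_nonneg ind_nonneg ind_nonneg) (Finset.sum_nonneg hnn)
    obtain ⟨h1, h2, h3, h4⟩ := h
    have hE : E ws := ⟨h1, h3⟩
    refine ind_le_one.trans ?_
    rcases h4 hsr with h5 | ⟨x, hx, h5⟩
    · rw [ind_of h5, ind_of hE, one_mul]
      linarith [Finset.sum_nonneg hnn]
    · refine le_add_of_nonneg_of_le (mul_nonneg ind_nonneg ind_nonneg) ?_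
      refine le_trans (le_of_eq ?_) (Finset.single_le_sum hnn (Finset.mem_filter.2
        ⟨Finset.mem_univ x, hx⟩))
      rw [ind_of (show E' ws from ⟨hE, h2⟩), ind_of, one_mul]
      exact fun g hg => h5 g (Finset.mem_sdiff.1 hg).1 (Finset.mem_sdiff.1 hg).2
  refine (womenAvg_mono hpt).trans ?_
  rw [womenAvg, productAvg_add, productAvg_sum]
  have h1 := womenAvg_gap_le hp hy hyq (s := s) hk (fun _ => ind_nonneg) hcolad
  have h2 : ∑ x ∈ B, womenAvg p (fun ws => ind (E' ws) *
      ind (∀ g ∈ G x ws, ¬ ∀ j : Fin M, s + k ≤ (j : ℕ) → (ws g).Prefers x j)) ≤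
      k * ((1 - q) ^ L * (1 / y) ^ (k - 1)) := by
    refine (Finset.sum_le_sum huns).trans ?_
    rw [Finset.sum_const, nsmul_eq_mul]
    gcongr
  refine (add_le_add h1 h2).trans (le_of_eq ?_)
  ring

end Profile

namespace Profile

variable {M W : ℕ} {p : Fin W → PMF (PrefList M)} {A b : ℝ}

theorem expectation_isBadBlock_le (hp : GeometricOdds p A b) {y : ℝ} (hy : 1 < y)
    (hyq : ∀ D, ∑ d ∈ Finset.range D, A / (1 - b) ^ 2 * b ^ d * (y ^ (d + 1) - 1) ≤
      Real.exp (-(A / (1 - b) ^ 2))) {s k L : ℕ} (hk : 1 ≤ k) (hsM : s ≤ M) (hsW : s < W) :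
    expectation p (fun P => ind (P.IsBadBlock s k (k + L))) ≤
      (1 / y) ^ (k - 1) * ((k : ℝ) ^ 2 * ((k + L : ℕ) / ((W : ℝ) - s)) +
        k * (1 - Real.exp (-(A / (1 - b) ^ 2))) ^ L) := by
  have hq1 : 0 ≤ 1 - Real.exp (-(A / (1 - b) ^ 2)) :=
    sub_nonneg.2 (Real.exp_le_one_iff.2 (neg_nonpos.2 (div_nonneg hp.A_nonneg (sq_nonneg _))))
  have hy0 : 0 < y := by linarith
  have hWs : (0 : ℝ) < (W : ℝ) - s := sub_pos.2 (by exact_mod_cast hsW)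
  rw [expectation_eq]
  rcases le_or_gt (s + (k + L)) W with hsr | hsr
  · refine (menAvg_mono fun ms => womenAvg_isBadBlock_le hp hy hyq hk hsM hsr).trans ?_
    rw [menAvg, productAvg_const_mul, productAvg_add]
    refine mul_le_mul_of_nonneg_left (add_le_add ?_ ?_) (by positivity)
    · have := expectation_collides_le (p := p) (s := s) (k := k) (r := k + L) hsW
      rwa [expectation_eq] at this
    · exact (menAvg_const _).le
  -- Too few women remain for `k + L` favourites. Then `(k + L) / (W - s)` exceeds `1`, and the
  -- gap's tail alone suffices.
  · have h1 : ∀ ms : Fin M → PrefList W,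
        womenAvg p (fun ws => ind (IsBadBlock (ms, ws) s k (k + L))) ≤ (1 / y) ^ (k - 1) := by
      intro ms
      have h1 := womenAvg_gap_le hp hy hyq (s := s) hk (ms := ms) (Ψ := fun _ => 1)
        (fun _ => zero_le_one) (fun _ _ _ _ => rfl)
      rw [womenAvg_const, mul_one] at h1
      refine (womenAvg_mono fun ws => ?_).trans h1
      rw [one_mul]
      exact ind_mono fun h => ⟨h.1, h.2.2.1⟩
    refine (menAvg_mono h1).trans ((menAvg_const _).le.trans ?_)
    refine le_mul_of_one_le_right (by positivity) ?_
    have h2 : (1 : ℝ) ≤ (k : ℝ) ^ 2 := one_le_pow₀ (by exact_mod_cast hk)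
    have h3 : (1 : ℝ) ≤ (k + L : ℕ) / ((W : ℝ) - s) := by
      rw [one_le_div hWs]
      have : (W : ℝ) ≤ s + (k + L : ℕ) := by exact_mod_cast hsr.le
      linarith
    have h4 : 0 ≤ (k : ℝ) * (1 - Real.exp (-(A / (1 - b) ^ 2))) ^ L := by positivity
    have := one_le_mul_of_one_le_of_one_le h2 h3
    linarith

theorem expectation_numNonRigid_le_sum (hp : GeometricOdds p A b) {y : ℝ} (hy : 1 < y)
    (hyq : ∀ D, ∑ d ∈ Finset.range D, A / (1 - b) ^ 2 * b ^ d * (y ^ (d + 1) - 1) ≤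
      Real.exp (-(A / (1 - b) ^ 2))) (L : ℕ) :
    expectation p (fun P => (P.numNonRigid : ℝ)) ≤
      (∑' d : ℕ, ((d : ℝ) + 1) ^ 4 * (1 / y) ^ d) * ∑ s ∈ Finset.range (min M W),
        ((L + 1 : ℝ) * (1 / ((min M W : ℕ) - s : ℝ)) +
          (1 - Real.exp (-(A / (1 - b) ^ 2))) ^ L) := by
  set q := Real.exp (-(A / (1 - b) ^ 2)) with hq
  have hq1 : 0 ≤ 1 - q :=
    sub_nonneg.2 (Real.exp_le_one_iff.2 (neg_nonpos.2 (div_nonneg hp.A_nonneg (sq_nonneg _))))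
  have hy0 : 0 < y := by linarith
  have hz1 : 1 / y < 1 := by rw [div_lt_one hy0]; exact hy
  have hpt : ∀ P : Profile M W, (P.numNonRigid : ℝ) ≤ ∑ s ∈ Finset.range (min M W),
      ∑ k ∈ Finset.Icc 1 M, (k : ℝ) * ind (P.IsBadBlock s k (k + L)) := by
    intro P
    have h : (P.numNonRigid : ℝ) ≤ _ := Nat.cast_le.2 (P.numNonRigid_le
      -- The maximum only matters at `k = 0`, which does not occur in the sum.
      (fun k => max 1 (k + L)) fun k => le_max_left _ _)
    refine h.trans (le_of_eq ?_)
    push_cast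
    refine Finset.sum_congr rfl fun s _ => Finset.sum_congr rfl fun k hk => ?_
    have hk1 := (Finset.mem_Icc.1 hk).1
    rw [max_eq_right (show 1 ≤ k + L by omega)]
    rfl
  refine (expectation_mono hpt).trans ?_
  simp only [expectation_sum, expectation_const_mul]
  rw [Finset.mul_sum]
  refine Finset.sum_le_sum fun s hs => ?_
  have hs' := Finset.mem_range.1 hs
  have hsM : s < M := by omega
  have hsW : s < W := by omega
  set D : ℝ := (L + 1 : ℝ) * (1 / ((min M W : ℕ) - s : ℝ)) + (1 - q) ^ L with hD
  have hNs : (0 : ℝ) < (min M W : ℕ) - (s : ℝ) := sub_pos.2 (by exact_mod_cast hs')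
  have hNW : ((min M W : ℕ) : ℝ) - s ≤ (W : ℝ) - s := by
    have : ((min M W : ℕ) : ℝ) ≤ W := by exact_mod_cast min_le_right M W
    linarith
  -- The fourth power collects one `k` for the men of the block, `k ^ 2` for the pairs and one from
  -- `k + L ≤ k * (L + 1)`.
  have hterm : ∀ k ∈ Finset.Icc 1 M,
      (k : ℝ) * expectation p (fun P => ind (P.IsBadBlock s k (k + L))) ≤
        (k : ℝ) ^ 4 * (1 / y) ^ (k - 1) * D := by
    intro k hk
    have hk1 := (Finset.mem_Icc.1 hk).1
    have hk1' : (1 : ℝ) ≤ k := by exact_mod_cast hk1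
    have h1 := expectation_isBadBlock_le hp hy hyq (L := L) hk1 hsM.le hsW
    have h2 : ((k + L : ℕ) : ℝ) ≤ k * (L + 1) := by
      push_cast
      have : (0 : ℝ) ≤ L := Nat.cast_nonneg L
      nlinarith
    have h3 : ((k + L : ℕ) : ℝ) / ((W : ℝ) - s) ≤ k * ((L + 1) * (1 / ((min M W : ℕ) - s : ℝ))) :=
      calc _ ≤ k * (L + 1) / ((min M W : ℕ) - s : ℝ) := by gcongr
        _ = _ := by ring
    have h4 : (k : ℝ) * (1 - q) ^ L ≤ (k : ℝ) ^ 3 * (1 - q) ^ L :=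
      mul_le_mul_of_nonneg_right (le_self_pow₀ hk1' (by norm_num)) (by positivity)
    calc _ ≤ (k : ℝ) * ((1 / y) ^ (k - 1) * ((k : ℝ) ^ 2 * ((k + L : ℕ) / ((W : ℝ) - s)) +
          k * (1 - q) ^ L)) := by gcongr
      _ ≤ (k : ℝ) * ((1 / y) ^ (k - 1) *
          ((k : ℝ) ^ 2 * (k * ((L + 1) * (1 / ((min M W : ℕ) - s : ℝ)))) +
          (k : ℝ) ^ 3 * (1 - q) ^ L)) := by gcongr
      _ = _ := by rw [hD]; ring
  refine (Finset.sum_le_sum hterm).trans ?_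
  rw [← Finset.sum_mul]
  refine mul_le_mul_of_nonneg_right ?_ (by rw [hD]; positivity)
  have h5 : ∑ k ∈ Finset.Icc 1 M, (k : ℝ) ^ 4 * (1 / y) ^ (k - 1) =
      ∑ d ∈ Finset.range M, ((d : ℝ) + 1) ^ 4 * (1 / y) ^ d := by
    refine (Finset.sum_bij (fun d _ => d + 1) (fun d hd => ?_) (fun _ _ _ _ h => by omega)
      (fun k hk => ?_) fun d _ => ?_).symm
    · have := Finset.mem_range.1 hd
      exact Finset.mem_Icc.2 ⟨by omega, by omega⟩
    · have := Finset.mem_Icc.1 hk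
      exact ⟨k - 1, Finset.mem_range.2 (by omega), by omega⟩
    · simp
  rw [h5]
  exact (summable_succ_pow_mul_geometric (by positivity) hz1 4).sum_le_tsum _
    fun d _ => by positivity

theorem sum_one_div_sub_le (N : ℕ) :
    ∑ s ∈ Finset.range N, 1 / ((N : ℝ) - s) ≤ 1 + Real.log N := by
  have h := harmonic_le_one_add_log N
  refine le_trans (le_of_eq ?_) h
  rw [harmonic, ← Finset.sum_range_reflect]
  push_cast
  refine Finset.sum_congr rfl fun s hs => ?_
  have := Finset.mem_range.1 hs
  rw [Nat.cast_sub (by omega), Nat.cast_sub (by omega), one_div]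
  congr 1
  push_cast
  ring

/-- The expected number of men whose situation depends on the stable matching is polylogarithmic
in the size of the market. -/
theorem exists_expectation_numNonRigid_le (A c : ℝ) (hA : 0 < A) (hc : 0 < c) :
    ∃ K : ℝ, 0 ≤ K ∧ ∀ (M W : ℕ) (p : Fin W → PMF (PrefList M)),
      (∀ w, IsRegularPref (p w)) →
      (∀ k : ℕ, 1 ≤ k → maxOdds p k ≤ ENNReal.ofReal (A * Real.exp (-(c * k)))) →
      expectation p (fun P => (P.numNonRigid : ℝ)) ≤
        K * (1 + Real.log ((min M W : ℕ) : ℝ)) ^ 2 := by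
  set b := Real.exp (-c) with hb
  have hb0 : 0 < b := Real.exp_pos _
  have hb1 : b < 1 := by rw [hb]; simpa using hc
  set C := A / (1 - b) ^ 2 with hC
  have hC0 : 0 < C := div_pos hA (pow_pos (by linarith) 2)
  set q := Real.exp (-C) with hq
  have hq0 : 0 < q := Real.exp_pos _
  have hq1 : 0 ≤ 1 - q := sub_nonneg.2 (Real.exp_le_one_iff.2 (by linarith))
  obtain ⟨y, hy, hyq⟩ := exists_rate hC0.le hb0 hb1 hq0
  have hy0 : 0 < y := by linarith
  set K := ∑' d : ℕ, ((d : ℝ) + 1) ^ 4 * (1 / y) ^ d with hK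
  have hK0 : 0 ≤ K := tsum_nonneg fun d => by positivity
  refine ⟨K * (3 + 1 / q), by positivity, fun M W p hreg hodds => ?_⟩
  have hp := geometricOdds_of_maxOdds hA hc hreg hodds
  set N := min M W with hN
  set l := Real.log N with hl
  have hl0 : 0 ≤ l := Real.log_natCast_nonneg N
  -- This choice makes `(1 - q) ^ L ≤ exp (-q * L) ≤ 1 / N`, so that the unsaved men contribute at
  -- most a constant in total.
  set L := ⌈l / q⌉₊ with hL
  have hL1 : (L : ℝ) ≤ l / q + 1 := (Nat.ceil_lt_add_one (by positivity)).le
  have hL2 : l ≤ q * L := by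
    have := Nat.le_ceil (l / q)
    rw [div_le_iff₀ hq0] at this
    linarith
  have hNL : N * (1 - q) ^ L ≤ 1 := by
    rcases Nat.eq_zero_or_pos N with h0 | h0
    · rw [h0]; simp
    have h1 : (1 - q) ^ L ≤ Real.exp (-l) := by
      calc (1 - q) ^ L ≤ Real.exp (-q) ^ L := by
            gcongr
            linarith [Real.add_one_le_exp (-q)]
        _ = Real.exp (-(q * L)) := by rw [← Real.exp_nat_mul]; ring_nf
        _ ≤ _ := Real.exp_le_exp.2 (neg_le_neg hL2)
    have hN0 : (0 : ℝ) < N := by exact_mod_cast h0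
    rw [Real.exp_neg, Real.exp_log hN0] at h1
    calc _ ≤ (N : ℝ) * (N : ℝ)⁻¹ := by gcongr
      _ = 1 := mul_inv_cancel₀ hN0.ne'
  have hmain := expectation_numNonRigid_le_sum hp hy hyq L
  refine hmain.trans ?_
  rw [mul_assoc]
  refine mul_le_mul_of_nonneg_left ?_ hK0
  rw [Finset.sum_add_distrib, ← Finset.mul_sum, Finset.sum_const, Finset.card_range,
    nsmul_eq_mul]
  have h2 := sum_one_div_sub_le N
  have h3 : (L + 1 : ℝ) * ∑ s ∈ Finset.range N, 1 / ((N : ℝ) - s) ≤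
      (l / q + 2) * (1 + l) := by
    refine mul_le_mul (by linarith) h2 (Finset.sum_nonneg fun s hs => ?_) (by positivity)
    have : (s : ℝ) < N := by exact_mod_cast Finset.mem_range.1 hs
    exact one_div_nonneg.2 (by linarith)
  refine (add_le_add h3 hNL).trans ?_
  have h4 : 0 ≤ 1 / q := by positivity
  have h5 : l / q = 1 / q * l := by ring
  rw [h5]
  nlinarith [mul_nonneg h4 hl0, mul_nonneg hl0 hl0]

end Profile

/-! ### Conclusion -/

open Filter in
theorem tendsto_one_add_log_sq_div (K : ℝ) :
    Tendsto (fun n : ℕ => 2 * (K * (1 + Real.log n) ^ 2) / n) atTop (nhds 0) := by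
  have h : ∀ k : ℕ, Tendsto (fun n : ℕ => Real.log n ^ k / (n : ℝ)) atTop (nhds 0) := fun k =>
    ((Real.isLittleO_pow_log_id_atTop (n := k)).tendsto_div_nhds_zero).comp tendsto_natCast_atTop_atTop
  have h2 := (((h 0).add ((h 1).const_mul 2)).add (h 2)).const_mul (2 * K)
  simp only [mul_zero, add_zero] at h2
  refine h2.congr fun n => ?_
  ring

theorem theorem2 (A c : ℝ) (hA : 0 < A) (hc : 0 < c) :
    (∀ ε : ℝ, 0 < ε → ∃ n₀ : ℕ, ∀ (M W : ℕ) (p : Fin W → PMF (PrefList M)),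
      (∀ w, IsRegularPref (p w)) →
      (∀ k : ℕ, 1 ≤ k → maxOdds p k ≤ ENNReal.ofReal (A * Real.exp (-(c * k)))) →
      n₀ ≤ M + W →
      expectation p (fun P =>
        ((P.numMenSeveral : ℝ) + (P.numWomenSeveral : ℝ)) / ((M : ℝ) + (W : ℝ))) ≤ ε) ∧
    (∃ K : ℝ, ∀ (M W : ℕ) (p : Fin W → PMF (PrefList M)),
      (∀ w, IsRegularPref (p w)) →
      (∀ k : ℕ, 1 ≤ k → maxOdds p k ≤ ENNReal.ofReal (A * Real.exp (-(c * k)))) →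
      2 ≤ min M W →
      expectation p (fun P => (P.numWomenSeveral : ℝ)) ≤
        K * Real.log ((min M W : ℕ) : ℝ) ^ 2) := by
  obtain ⟨K, hK0, hK⟩ := Profile.exists_expectation_numNonRigid_le A c hA hc
  constructor
  · intro ε hε
    obtain ⟨n₀, hn₀⟩ := Filter.eventually_atTop.1
      ((tendsto_one_add_log_sq_div K).eventually (gt_mem_nhds hε))
    -- The `1` ensures that `M + W` is positive.
    refine ⟨max n₀ 1, fun M W p hreg hodds hn => ?_⟩
    have h1 := hn₀ (M + W) (by omega)
    have hpos : (0 : ℝ) < (M : ℝ) + W := by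
      have : 0 < M + W := by omega
      exact_mod_cast this
    have h2 := hK M W p hreg hodds
    have h3 : Real.log ((min M W : ℕ) : ℝ) ≤ Real.log ((M + W : ℕ) : ℝ) := by
      rcases Nat.eq_zero_or_pos (min M W) with h0 | h0
      · rw [h0, Nat.cast_zero, Real.log_zero]
        exact Real.log_natCast_nonneg _
      · exact Real.log_le_log (by exact_mod_cast h0) (by
          exact_mod_cast (min_le_left M W).trans (Nat.le_add_right M W))
    have h4 : 0 ≤ Real.log ((min M W : ℕ) : ℝ) := Real.log_natCast_nonneg _
    calc _ ≤ expectation p (fun P => 2 / ((M : ℝ) + W) * (P.numNonRigid : ℝ)) := by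
          refine Profile.expectation_mono fun P => ?_
          have h5 : (P.numMenSeveral : ℝ) ≤ P.numNonRigid := by
            exact_mod_cast P.numMenSeveral_le
          have h6 : (P.numWomenSeveral : ℝ) ≤ P.numNonRigid := by
            exact_mod_cast P.numWomenSeveral_le
          rw [div_mul_eq_mul_div]
          gcongr
          linarith
      _ = 2 / ((M : ℝ) + W) * expectation p (fun P => (P.numNonRigid : ℝ)) :=
          Profile.expectation_const_mul _ _
      _ ≤ 2 / ((M : ℝ) + W) * (K * (1 + Real.log ((M + W : ℕ) : ℝ)) ^ 2) := by
          refine mul_le_mul_of_nonneg_left (h2.trans ?_) (by positivity)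
          gcongr
      _ = 2 * (K * (1 + Real.log ((M + W : ℕ) : ℝ)) ^ 2) / ((M + W : ℕ) : ℝ) := by
          push_cast; ring
      _ ≤ ε := h1.le
  -- For `N ≥ 2` the summand `1` in `1 + log N` is at most `log N / log 2`.
  · refine ⟨K * (1 / Real.log 2 + 1) ^ 2, fun M W p hreg hodds hN => ?_⟩
    have h2 := hK M W p hreg hodds
    have hlog2 : 0 < Real.log 2 := Real.log_pos (by norm_num)
    have h3 : Real.log 2 ≤ Real.log ((min M W : ℕ) : ℝ) :=
      Real.log_le_log (by norm_num) (by exact_mod_cast hN)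
    set l := Real.log ((min M W : ℕ) : ℝ) with hl
    have h4 : 1 + l ≤ (1 / Real.log 2 + 1) * l := by
      have : 1 ≤ 1 / Real.log 2 * l := by
        rw [one_div_mul_eq_div, one_le_div hlog2]
        exact h3
      linarith
    calc _ ≤ expectation p (fun P => (P.numNonRigid : ℝ)) :=
          Profile.expectation_mono fun P => by exact_mod_cast P.numWomenSeveral_le
      _ ≤ K * (1 + l) ^ 2 := h2
      _ ≤ K * ((1 / Real.log 2 + 1) * l) ^ 2 := by gcongr
      _ = _ := by ring
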